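/- **Theorem.** An Orlicz function is a non-decreasing convex function $\varphi:[0,\infty)\to[0,\infty)$ with $\varphi(0)=0$ and $\varphi(1)=1$. For $p\in[1,\infty)$, $\varphi$ is *similar* to $t^p$ if there are $C,t_0>0$ with $\varphi(t)=Ct^p$ for all $0\le t<t_0$, and *equivalent* to $t^p$ if there are $C_1,C_2,t_0>0$ with $C_1t^p\le\varphi(t)\le C_2t^p$ for all $0\le t<t_0$. For a countable (finite or infinite) index set $I$, the real Orlicz sequence space $\ell_\varphi$ consists of all $x=(x_i)_{i\in I}\in\mathbb R^I$ with $\sum_{i}\varphi(|x_i|/\lambda)<\infty$ for some $\lambda>0$. Its Luxemburg norm is $\|x\|_\varphi=\inf\{\lambda>0:\sum_i\varphi(|x_i|/\lambda)\le1\}$ and its Orlicz norm is $\|x\|_{\varphi,O}=\sup\{\sum_i x_iy_i:\sum_i\varphi^*(|y_i|)\le1\}$, where $\varphi^*(u)=\sup_{t>0}(tu-\varphi(t))$ for $u\ge0$. Let $(e_i)_{i\in I}$ be the unit vectors of $\ell_\varphi$. Let $\varphi$ be an Orlicz function with $\varphi(t)>0$ for all $t>0$ which is not similar to $t^2$. Consider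 $\ell_\varphi$ with either the Luxemburg norm or the Orlicz norm, where in the case of the Orlicz norm $\varphi^*(u)<\infty$ for all $u\ge 0$. Let $F\subset\ell_\varphi$ be a linear subspace of codimension $n$ with $\dim F>1$ which contains at least one of the vectors $e_i$. Suppose that $F$ is 1-complemented in $\ell_\varphi$, that is, $F$ is the range of a linear projection $\ell_\varphi\to\ell_\varphi$ of norm $1$. Then there are finitely supported sequences $f_j=(f_{ji})_{i\in I}$, $j=1,\dots,n$, regarded as the functionals $f_j(x)=\sum_i f_{ji}x_i$, such that $$F=\bigcap_{j=1}^n\ker f_j\quad\text{and}\quad \operatorname{card}(\operatorname{supp} f_j)\le2\ \text{ for all } j\le n,$$ and such that moreover: (a) if $\varphi$ is not equivalent to $t^p$ for any $p\in[1,\infty)$, then $|f_{ji}|\in\{0,1\}$ for all $i,j$; (b) if, for some $p\in[1,\infty)$, $\varphi$ is equivalent but not similar to $t^p$, then there is $\gamma\ge1$ such that $|f_{ji}|\in\{\gamma^m:m\in\mathbb Z\}\cup\{0\}$ for all $i,j$. -/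

import Mathlib

open scoped ENNReal

noncomputable section

/-- Orlicz functions `φ : [0, ∞) → [0, ∞)`. Only the values of `φ` on `[0, ∞)` matter;
nonnegativity there follows from `φ 0 = 0` and monotonicity. -/
structure IsOrliczFunction (φ : ℝ → ℝ) : Prop where
  map_zero : φ 0 = 0
  map_one : φ 1 = 1
  monotone : MonotoneOn φ (Set.Ici 0)
  convex : ConvexOn ℝ (Set.Ici 0) φ

/-- `φ` is similar to `t ^ p`: it equals `C t ^ p` near `0`. -/
def SimilarToPow (φ : ℝ → ℝ) (p : ℝ) : Prop :=
  ∃ C > 0, ∃ t₀ > 0, ∀ t : ℝ, 0 ≤ t → t < t₀ → φ t = C * t ^ p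

/-- `φ` is equivalent to `t ^ p` near `0`. -/
def EquivalentToPow (φ : ℝ → ℝ) (p : ℝ) : Prop :=
  ∃ C₁ > 0, ∃ C₂ > 0, ∃ t₀ > 0, ∀ t : ℝ, 0 ≤ t → t < t₀ →
    C₁ * t ^ p ≤ φ t ∧ φ t ≤ C₂ * t ^ p

/-- The complementary function `φ* (u) = sup_{t > 0} (t u - φ t)`, `u ≥ 0`, with values in
`[0, ∞]`. (Truncating at `0` is harmless: `t u - φ t → 0` as `t → 0`.) -/
def youngConj (φ : ℝ → ℝ) (u : ℝ) : ℝ≥0∞ :=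
  ⨆ t : {t : ℝ // 0 < t}, ENNReal.ofReal (t * u - φ t)

/-- The modular `∑ φ (|x_i|)`, with values in `[0, ∞]`. -/
def orliczModular {ι : Type*} (φ : ℝ → ℝ) (x : ι → ℝ) : ℝ≥0∞ :=
  ∑' i, ENNReal.ofReal (φ |x i|)

theorem IsOrliczFunction.nonneg {φ : ℝ → ℝ} (hφ : IsOrliczFunction φ) {t : ℝ} (ht : 0 ≤ t) :
    0 ≤ φ t := by
  have := hφ.monotone (Set.mem_Ici.2 le_rfl) (Set.mem_Ici.2 ht) ht
  rwa [hφ.map_zero] at this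

theorem IsOrliczFunction.modular_add_lt_top {ι : Type*} {φ : ℝ → ℝ} (hφ : IsOrliczFunction φ)
    {x y : ι → ℝ} {a b : ℝ} (ha : 0 < a) (hb : 0 < b)
    (hx : orliczModular φ (fun i => x i / a) < ∞)
    (hy : orliczModular φ (fun i => y i / b) < ∞) :
    orliczModular φ (fun i => (x i + y i) / (a + b)) < ∞ := by
  have hab : 0 < a + b := by positivity
  refine lt_of_le_of_lt ?_ (ENNReal.add_lt_top.2 ⟨hx, hy⟩)
  unfold orliczModular
  rw [← ENNReal.tsum_add]
  refine ENNReal.tsum_le_tsum fun i => ?_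
  have h0x : 0 ≤ |x i / a| := abs_nonneg _
  have h0y : 0 ≤ |y i / b| := abs_nonneg _
  rw [← ENNReal.ofReal_add (hφ.nonneg h0x) (hφ.nonneg h0y)]
  refine ENNReal.ofReal_le_ofReal ?_
  have hsum : a / (a + b) + b / (a + b) = 1 := by field_simp
  have hle : |(x i + y i) / (a + b)| ≤
      (a / (a + b)) • |x i / a| + (b / (a + b)) • |y i / b| := by
    have e1 : (a / (a + b)) • |x i / a| = |x i| / (a + b) := by
      rw [abs_div, abs_of_pos ha, smul_eq_mul]; field_simp
    have e2 : (b / (a + b)) • |y i / b| = |y i| / (a + b) := by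
      rw [abs_div, abs_of_pos hb, smul_eq_mul]; field_simp
    rw [e1, e2, abs_div, abs_of_pos hab, ← add_div]
    exact div_le_div_of_nonneg_right (abs_add_le _ _) hab.le
  have h1 := hφ.monotone (Set.mem_Ici.2 (abs_nonneg _))
    (Set.mem_Ici.2 ((abs_nonneg _).trans hle)) hle
  have h2 := hφ.convex.2 (Set.mem_Ici.2 h0x) (Set.mem_Ici.2 h0y)
    (by positivity : 0 ≤ a / (a + b)) (by positivity : 0 ≤ b / (a + b)) hsum
  have h3 : a / (a + b) ≤ 1 := by rw [← hsum]; linarith [show 0 ≤ b / (a + b) by positivity]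
  have h4 : b / (a + b) ≤ 1 := by rw [← hsum]; linarith [show 0 ≤ a / (a + b) by positivity]
  have h5 := mul_le_of_le_one_left (hφ.nonneg h0x) h3
  have h6 := mul_le_of_le_one_left (hφ.nonneg h0y) h4
  simp only [smul_eq_mul] at h1 h2
  linarith

/-- The real Orlicz sequence space: all families `x` with `∑ φ (|x_i| / r) < ∞` for some
`r > 0`. -/
def orliczSpace (ι : Type*) {φ : ℝ → ℝ} (hφ : IsOrliczFunction φ) : Submodule ℝ (ι → ℝ) where
  carrier := {x | ∃ r : ℝ, 0 < r ∧ orliczModular φ (fun i => x i / r) < ∞}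
  zero_mem' := ⟨1, one_pos, by simp [orliczModular, hφ.map_zero]⟩
  add_mem' := by
    rintro x y ⟨a, ha, hx⟩ ⟨b, hb, hy⟩
    exact ⟨a + b, add_pos ha hb, hφ.modular_add_lt_top ha hb hx hy⟩
  smul_mem' := by
    rintro c x ⟨a, ha, hx⟩
    by_cases hc : c = 0
    · exact ⟨1, one_pos, by simp [hc, orliczModular, hφ.map_zero]⟩
    · have hc' : 0 < |c| := abs_pos.2 hc
      refine ⟨|c| * a, by positivity, ?_⟩
      have : orliczModular φ (fun i => (c • x) i / (|c| * a)) =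
          orliczModular φ (fun i => x i / a) := by
        unfold orliczModular
        refine tsum_congr fun i => ?_
        have : |(c • x) i / (|c| * a)| = |x i / a| := by
          rw [Pi.smul_apply, smul_eq_mul, abs_div, abs_mul, abs_mul, abs_abs, abs_div]
          field_simp
        simp only [this]
      rw [this]; exact hx

/-- The Luxemburg norm. -/
def luxemburgNorm {ι : Type*} (φ : ℝ → ℝ) (x : ι → ℝ) : ℝ :=
  sInf {r : ℝ | 0 < r ∧ orliczModular φ (fun i => x i / r) ≤ 1}

/-- The Orlicz norm `sup {∑ x_i y_i : ∑ φ* (|y_i|) ≤ 1}`. -/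
def orliczNorm {ι : Type*} (φ : ℝ → ℝ) (x : ι → ℝ) : ℝ :=
  sSup {s : ℝ | ∃ y : ι → ℝ, ∑' i, youngConj φ |y i| ≤ 1 ∧ HasSum (fun i => x i * y i) s}

open Classical in
/-- The basis vector `e_i` of the Orlicz space. -/
def orliczBasisVector {ι : Type*} {φ : ℝ → ℝ} (hφ : IsOrliczFunction φ) (i : ι) :
    orliczSpace ι hφ :=
  ⟨Pi.single i 1, 1, one_pos, by
    unfold orliczModular
    rw [tsum_eq_single i]
    · exact ENNReal.ofReal_lt_top
    · intro j hj
      simp [Pi.single_eq_of_ne hj, hφ.map_zero]⟩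

/-- The functional `x ↦ ∑ a_i x_i` on the Orlicz space, for finitely supported `a`; its value
at `e_i` is `a_i`. -/
def coordFunctional {ι : Type*} {φ : ℝ → ℝ} (hφ : IsOrliczFunction φ) (a : ι →₀ ℝ) :
    orliczSpace ι hφ →ₗ[ℝ] ℝ :=
  ∑ i ∈ a.support, a i • (LinearMap.proj i ∘ₗ (orliczSpace ι hφ).subtype)

/-- `F` is 1-complemented for the norm `N`: it is the range of a linear projection of the whole
space whose operator norm (the least admissible constant) is `1`. -/
def IsOneComplemented {ι : Type*} {φ : ℝ → ℝ} (hφ : IsOrliczFunction φ)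
    (N : (ι → ℝ) → ℝ) (F : Submodule ℝ (orliczSpace ι hφ)) : Prop :=
  ∃ P : orliczSpace ι hφ →ₗ[ℝ] orliczSpace ι hφ,
    P ∘ₗ P = P ∧ LinearMap.range P = F ∧
      IsLeast {C : ℝ | 0 ≤ C ∧ ∀ x, N (P x) ≤ C * N x} 1

end

open Filter Topology

/-! ### Convexity of `φ |t|` and its one-sided derivative. -/

namespace IsOrliczFunction

variable {φ : ℝ → ℝ}

/-! Put Q = 1 - P, so that F = ker Q and x ↦ x - Qx is contractive, and let e_o be a basis vector in
F. Since Q does not see e_o, that coordinate can absorb norm. A small finite vector z off o is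
completed to X = z ± c e_o so that the vector (φ'(z_i)), with a further entry ±u at o, is a
supporting functional y at X. Contractivity gives y(QX) ≥ 0, and averaging over the sign removes o:
Σ φ'(z_i)(Qz)_i ≥ 0, for both norms (`sum_oddRightDeriv_nonneg`). Perturbing a small x in ker Q in
opposite directions turns this into Σ φ'(x_i)(Qh)_i = 0, and integration along the ray through x
replaces φ' by g(t) = φ(|t|)/t, which is continuous off 0 (`sum_div_eq_zero`).

Choose a finite family e_{a k} with Q e_{a k} independent and Q e_i = Σ_k c_{ki} Q e_{a k} for all
i. Prescribing s outside the range of a and -Σ c_{ki} s_i at a k gives vectors of ker Q, and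
orthogonality becomes a relation between the numbers g(s_i) and g(Σ c_{ki} s_i). A duality argument
isolates one k, and letting unwanted coordinates tend to 0 leaves g(Σ_J c_{ki} p_i) = Σ_J w_i g(p_i)
for a finite set J (`exists_sparse_identity`).

If J has two elements with nonzero coefficients, this is a Pexider equation; its monotone solutions
g are linear, so φ would be similar to t². Hence each functional Σ_i c_{ki} x_i lives on a k and at
most one further index. If J = {i}, it says that φ(|c_{ki}| t) = K φ(t) near 0. When |c_{ki}| ≠ 1,
iteration makes φ equivalent to a power t^p. The logarithms of all such factors form a subgroup of
ℝ, which is cyclic unless φ is similar to t^p; this gives γ.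

Finitely supported vectors need not be dense, so passing from truncations to all of F needs its own
argument, again based on e_o (`eq_zero_of_truncations`). -/

theorem convexOn_comp_abs (hφ : IsOrliczFunction φ) :
    ConvexOn ℝ Set.univ (fun t => φ |t|) := by
  refine ⟨convex_univ, fun x _ y _ a b ha hb hab => ?_⟩
  have h1 : |a • x + b • y| ≤ a • |x| + b • |y| := by
    simp only [smul_eq_mul]
    calc |a * x + b * y| ≤ |a * x| + |b * y| := abs_add_le _ _
      _ = a * |x| + b * |y| := by rw [abs_mul, abs_mul, abs_of_nonneg ha, abs_of_nonneg hb]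
  exact (hφ.monotone (Set.mem_Ici.2 (abs_nonneg _))
    (Set.mem_Ici.2 ((abs_nonneg _).trans h1)) h1).trans
    (hφ.convex.2 (Set.mem_Ici.2 (abs_nonneg x)) (Set.mem_Ici.2 (abs_nonneg y)) ha hb hab)

theorem continuous_comp_abs (hφ : IsOrliczFunction φ) : Continuous (fun t => φ |t|) :=
  continuousOn_univ.1 (hφ.convexOn_comp_abs.continuousOn isOpen_univ)

theorem mul_le (hφ : IsOrliczFunction φ) {a t : ℝ} (ha : 0 ≤ a) (ha1 : a ≤ 1) (ht : 0 ≤ t) :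
    φ (a * t) ≤ a * φ t := by
  have := hφ.convex.2 (Set.mem_Ici.2 ht) (Set.mem_Ici.2 le_rfl) ha (sub_nonneg.2 ha1)
    (by ring)
  simpa [hφ.map_zero] using this

theorem exists_eq (hφ : IsOrliczFunction φ) {κ : ℝ} (h0 : 0 ≤ κ) (h1 : κ ≤ 1) :
    ∃ c, 0 ≤ c ∧ φ c = κ := by
  obtain ⟨c, hc, hc'⟩ := intermediate_value_Icc (zero_le_one' ℝ)
    hφ.continuous_comp_abs.continuousOn
    (show κ ∈ Set.Icc (φ |0|) (φ |1|) by simp [hφ.map_zero, hφ.map_one, h0, h1])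
  exact ⟨c, hc.1, by simpa [abs_of_nonneg hc.1] using hc'⟩

end IsOrliczFunction

/-- The odd extension of the right derivative of an Orlicz function. -/
noncomputable def oddRightDeriv (φ : ℝ → ℝ) (t : ℝ) : ℝ :=
  (SignType.sign t : ℝ) * derivWithin (fun s => φ |s|) (Set.Ioi |t|) |t|

theorem oddRightDeriv_zero (φ : ℝ → ℝ) : oddRightDeriv φ 0 = 0 := by simp [oddRightDeriv]

theorem oddRightDeriv_neg (φ : ℝ → ℝ) (t : ℝ) : oddRightDeriv φ (-t) = -oddRightDeriv φ t := by
  simp [oddRightDeriv, Left.sign_neg]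

theorem oddRightDeriv_of_pos (φ : ℝ → ℝ) {t : ℝ} (ht : 0 < t) :
    oddRightDeriv φ t = derivWithin (fun s => φ |s|) (Set.Ioi t) t := by
  simp [oddRightDeriv, abs_of_pos ht, sign_pos ht]

namespace IsOrliczFunction

variable {φ : ℝ → ℝ}

theorem hasDerivWithinAt_oddRightDeriv (hφ : IsOrliczFunction φ) {t : ℝ} (ht : 0 < t) :
    HasDerivWithinAt (fun s => φ |s|) (oddRightDeriv φ t) (Set.Ioi t) t := by
  rw [oddRightDeriv_of_pos φ ht]
  exact hφ.convexOn_comp_abs.hasDerivWithinAt_rightDeriv_of_mem_interior (by simp)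

theorem subgradient_of_pos (hφ : IsOrliczFunction φ) {a : ℝ} (ha : 0 < a) (b : ℝ) :
    φ |a| + oddRightDeriv φ a * (b - a) ≤ φ |b| := by
  rw [oddRightDeriv_of_pos φ ha]
  rcases lt_trichotomy a b with h | h | h
  · have := hφ.convexOn_comp_abs.rightDeriv_le_slope_of_mem_interior (x := a) (y := b)
      (by simp) (Set.mem_univ _) h
    rw [slope_def_field, le_div_iff₀ (sub_pos.2 h)] at this
    linarith
  · simp [h]
  · have h1 := hφ.convexOn_comp_abs.leftDeriv_le_rightDeriv_of_mem_interior (x := a) (by simp)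
    have h2 := hφ.convexOn_comp_abs.slope_le_leftDeriv_of_mem_interior (x := b) (y := a)
      (Set.mem_univ _) (by simp) h
    have := h2.trans h1
    rw [slope_def_field, div_le_iff₀ (sub_pos.2 h)] at this
    linarith

/-- At a = 0 the function may have a corner; the value 0 is still a subgradient there because φ ≥ 0.
-/
theorem subgradient (hφ : IsOrliczFunction φ) (a b : ℝ) :
    φ |a| + oddRightDeriv φ a * (b - a) ≤ φ |b| := by
  rcases lt_trichotomy a 0 with h | h | h
  · have := hφ.subgradient_of_pos (neg_pos.2 h) (-b)
    rw [oddRightDeriv_neg, abs_neg, abs_neg] at this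
    linarith
  · simp [h, oddRightDeriv_zero, hφ.map_zero, hφ.nonneg]
  · exact hφ.subgradient_of_pos h b

theorem oddRightDeriv_mono (hφ : IsOrliczFunction φ) {a b : ℝ} (hab : a ≤ b) :
    oddRightDeriv φ a ≤ oddRightDeriv φ b := by
  rcases hab.eq_or_lt with rfl | hab
  · rfl
  have h1 := hφ.subgradient a b
  have h2 := hφ.subgradient b a
  nlinarith

theorem oddRightDeriv_nonneg (hφ : IsOrliczFunction φ) {a : ℝ} (ha : 0 ≤ a) :
    0 ≤ oddRightDeriv φ a := by
  simpa [oddRightDeriv_zero] using hφ.oddRightDeriv_mono ha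

theorem oddRightDeriv_mul_self (φ : ℝ → ℝ) (a : ℝ) :
    oddRightDeriv φ |a| * |a| = oddRightDeriv φ a * a := by
  rcases abs_choice a with h | h <;> simp [h, oddRightDeriv_neg]

theorem abs_oddRightDeriv (hφ : IsOrliczFunction φ) (a : ℝ) :
    |oddRightDeriv φ a| = oddRightDeriv φ |a| := by
  rcases le_total 0 a with h | h
  · rw [abs_of_nonneg h, abs_of_nonneg (hφ.oddRightDeriv_nonneg h)]
  · have := hφ.oddRightDeriv_nonneg (neg_nonneg.2 h)
    rw [abs_of_nonpos h, oddRightDeriv_neg, abs_of_nonpos]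
    rw [oddRightDeriv_neg] at this; linarith

/-- The right derivative at y is at most the slope from y to a fixed z > x, and that slope is
continuous in y; monotonicity gives the other bound. -/
theorem tendsto_oddRightDeriv_of_pos (hφ : IsOrliczFunction φ) {x : ℝ} (hx : 0 < x) :
    Tendsto (oddRightDeriv φ) (𝓝[>] x) (𝓝 (oddRightDeriv φ x)) := by
  refine tendsto_order.2 ⟨fun b hb => ?_, fun b hb => ?_⟩
  · filter_upwards [self_mem_nhdsWithin] with y hy
    exact hb.trans_le (hφ.oddRightDeriv_mono (le_of_lt hy))
  · have h1 := (hφ.hasDerivWithinAt_oddRightDeriv hx)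
    rw [hasDerivWithinAt_iff_tendsto_slope' (by simp)] at h1
    obtain ⟨z, hz, hzx⟩ := (((tendsto_order.1 h1).2 b hb).and self_mem_nhdsWithin).exists
    rw [slope_def_field] at hz
    have hc : Tendsto (fun y => (φ |z| - φ |y|) / (z - y)) (𝓝 x)
        (𝓝 ((φ |z| - φ |x|) / (z - x))) := by
      refine Tendsto.div ?_ ?_ (sub_pos.2 hzx).ne'
      · exact tendsto_const_nhds.sub (hφ.continuous_comp_abs.tendsto x)
      · exact tendsto_const_nhds.sub tendsto_id
    filter_upwards [nhdsWithin_le_nhds ((tendsto_order.1 hc).2 b hz),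
      nhdsWithin_le_nhds (eventually_lt_nhds hzx)] with y hy hyz
    refine lt_of_le_of_lt ?_ hy
    rw [le_div_iff₀ (sub_pos.2 hyz)]
    have := hφ.subgradient y z
    linarith

/-- The condition `0 < x * d` says that the point moves away from 0, the side on which the odd
extension is continuous. -/
theorem tendsto_oddRightDeriv_add_mul (hφ : IsOrliczFunction φ) {x d : ℝ} (hxd : 0 < x * d) :
    Tendsto (fun s => oddRightDeriv φ (x + s * d)) (𝓝[>] 0) (𝓝 (oddRightDeriv φ x)) := by
  have key : ∀ {x d : ℝ}, 0 < x → 0 < d →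
      Tendsto (fun s => oddRightDeriv φ (x + s * d)) (𝓝[>] 0) (𝓝 (oddRightDeriv φ x)) := by
    intro x d hx hd
    refine (hφ.tendsto_oddRightDeriv_of_pos hx).comp ?_
    refine tendsto_nhdsWithin_iff.2 ⟨?_, ?_⟩
    · refine Tendsto.mono_left ?_ nhdsWithin_le_nhds
      have : Continuous fun s : ℝ => x + s * d := by fun_prop
      simpa using this.tendsto 0
    · filter_upwards [self_mem_nhdsWithin] with s hs
      have := mul_pos (Set.mem_Ioi.1 hs) hd
      simp [this]
  rcases pos_and_pos_or_neg_and_neg_of_mul_pos hxd with ⟨hx, hd⟩ | ⟨hx, hd⟩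
  · exact key hx hd
  · have := (key (neg_pos.2 hx) (neg_pos.2 hd)).neg
    rw [oddRightDeriv_neg, neg_neg] at this
    refine this.congr fun s => ?_
    rw [← oddRightDeriv_neg]; congr 1; ring

theorem hasDerivWithinAt_ray (hφ : IsOrliczFunction φ) {τ x : ℝ} (hτ : 0 < τ) (hx : x ≠ 0) :
    HasDerivWithinAt (fun s => φ |s * x|) (oddRightDeriv φ (τ * x) * x) (Set.Ici τ) τ := by
  have hx' : 0 < |x| := abs_pos.2 hx
  have h1 : HasDerivWithinAt (fun s => φ |s|) (oddRightDeriv φ (τ * |x|)) (Set.Ici (τ * |x|))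
      (τ * |x|) := (hφ.hasDerivWithinAt_oddRightDeriv (mul_pos hτ hx')).Ici_of_Ioi
  have h2 : HasDerivWithinAt (fun s : ℝ => s * |x|) |x| (Set.Ici τ) τ :=
    (hasDerivAt_mul_const |x|).hasDerivWithinAt
  have h3 := h1.comp τ h2 (fun s hs => by
    simpa using mul_le_mul_of_nonneg_right (Set.mem_Ici.1 hs) hx'.le)
  have e1 : oddRightDeriv φ (τ * |x|) * |x| = oddRightDeriv φ (τ * x) * x := by
    rcases abs_choice x with h | h <;> simp [h, oddRightDeriv_neg]
  rw [e1] at h3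
  refine h3.congr (fun s _ => ?_) ?_ <;> simp [abs_mul]

/-- Young's inequality between `t` and `oddRightDeriv φ a` is an equality at `t = |a|`. -/
theorem mul_oddRightDeriv_sub_le (hφ : IsOrliczFunction φ) (a : ℝ) {t : ℝ} (ht : 0 ≤ t) :
    t * |oddRightDeriv φ a| - φ t ≤ oddRightDeriv φ a * a - φ |a| := by
  have := hφ.subgradient |a| t
  rw [abs_of_nonneg ht, abs_abs] at this
  rw [hφ.abs_oddRightDeriv, ← oddRightDeriv_mul_self]
  linarith

/-- The left side is the conjugate function at |φ'(a)|, by equality in Young's inequality. The bound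
lets smallness of Σ φ(|2 z_i|) control the dual modular too. -/
theorem oddRightDeriv_mul_self_sub_le (hφ : IsOrliczFunction φ) (a : ℝ) :
    oddRightDeriv φ a * a - φ |a| ≤ φ |2 * a| := by
  have := hφ.subgradient a (2 * a)
  have h2 := hφ.nonneg (abs_nonneg a)
  nlinarith

end IsOrliczFunction

/-! ### Modulars and the two norms. -/

namespace IsOrliczFunction

variable {φ : ℝ → ℝ} {ι : Type*}

theorem modular_of_support_subset (hφ : IsOrliczFunction φ) (S : Finset ι) {x : ι → ℝ}
    (hx : ∀ i, i ∉ S → x i = 0) :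
    orliczModular φ x = ENNReal.ofReal (∑ i ∈ S, φ |x i|) := by
  unfold orliczModular
  rw [tsum_eq_sum (s := S) (fun i hi => by simp [hx i hi, hφ.map_zero]),
    ENNReal.ofReal_sum_of_nonneg fun i _ => hφ.nonneg (abs_nonneg _)]

theorem sum_le_of_modular_le (hφ : IsOrliczFunction φ) {x : ι → ℝ} {m : ℝ} (hm : 0 ≤ m)
    (hx : orliczModular φ x ≤ ENNReal.ofReal m) (S : Finset ι) :
    ∑ i ∈ S, φ |x i| ≤ m := by
  rw [← ENNReal.ofReal_le_ofReal_iff hm,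
    ENNReal.ofReal_sum_of_nonneg fun i _ => hφ.nonneg (abs_nonneg _)]
  exact (ENNReal.sum_le_tsum S).trans hx

theorem modular_le_of_sum_le (hφ : IsOrliczFunction φ) {x : ι → ℝ} {m : ℝ}
    (hx : ∀ S : Finset ι, ∑ i ∈ S, φ |x i| ≤ m) :
    orliczModular φ x ≤ ENNReal.ofReal m := by
  unfold orliczModular
  rw [ENNReal.tsum_eq_iSup_sum]
  refine iSup_le fun S => ?_
  rw [← ENNReal.ofReal_sum_of_nonneg fun i _ => hφ.nonneg (abs_nonneg _)]
  exact ENNReal.ofReal_le_ofReal (hx S)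

theorem exists_modular_div_le_one (hφ : IsOrliczFunction φ) (x : orliczSpace ι hφ) :
    ∃ r : ℝ, 0 < r ∧ orliczModular φ (fun i => x.1 i / r) ≤ 1 := by
  obtain ⟨r, hr, hx⟩ := x.2
  set m := (orliczModular φ (fun i => x.1 i / r)).toReal
  have hm : 0 ≤ m := ENNReal.toReal_nonneg
  refine ⟨(m + 1) * r, by positivity, ?_⟩
  rw [← ENNReal.ofReal_one]
  refine hφ.modular_le_of_sum_le fun S => ?_
  have h1 := hφ.sum_le_of_modular_le hm (ENNReal.ofReal_toReal hx.ne).ge S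
  have h2 : ∀ i ∈ S, φ |x.1 i / ((m + 1) * r)| ≤ (m + 1)⁻¹ * φ |x.1 i / r| := by
    intro i _
    have : |x.1 i / ((m + 1) * r)| = (m + 1)⁻¹ * |x.1 i / r| := by
      rw [abs_div, abs_div, abs_mul, abs_of_pos (show 0 < m + 1 by positivity)]
      field_simp
    rw [this]
    exact hφ.mul_le (by positivity) (inv_le_one_of_one_le₀ (by linarith)) (abs_nonneg _)
  refine (Finset.sum_le_sum h2).trans ?_
  rw [← Finset.mul_sum, inv_mul_le_iff₀ (by positivity)]
  linarith

theorem luxemburgNorm_le_one {x : ι → ℝ} (hx : orliczModular φ x ≤ 1) :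
    luxemburgNorm φ x ≤ 1 :=
  csInf_le ⟨0, fun _ hr => hr.1.le⟩ ⟨one_pos, by simpa using hx⟩

theorem sum_le_one_of_luxemburgNorm_le_one (hφ : IsOrliczFunction φ) (x : orliczSpace ι hφ)
    (hx : luxemburgNorm φ x.1 ≤ 1) (S : Finset ι) : ∑ i ∈ S, φ |x.1 i| ≤ 1 := by
  have hr : ∀ r : ℝ, 1 < r → ∑ i ∈ S, φ |x.1 i / r| ≤ 1 := by
    intro r hr
    obtain ⟨r', ⟨hr0, hr'⟩, hlt⟩ := exists_lt_of_csInf_lt (hφ.exists_modular_div_le_one x)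
      (hx.trans_lt hr)
    refine le_trans (Finset.sum_le_sum fun i _ => ?_)
      (hφ.sum_le_of_modular_le zero_le_one (by simpa using hr') S)
    refine hφ.monotone (Set.mem_Ici.2 (abs_nonneg _)) (Set.mem_Ici.2 (abs_nonneg _)) ?_
    rw [abs_div, abs_div, abs_of_pos hr0, abs_of_pos (hr0.trans hlt)]
    exact div_le_div_of_nonneg_left (abs_nonneg _) hr0 hlt.le
  have hc : Tendsto (fun r : ℝ => ∑ i ∈ S, φ |x.1 i / r|) (𝓝[>] 1) (𝓝 (∑ i ∈ S, φ |x.1 i / 1|)) := by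
    refine Tendsto.mono_left ?_ nhdsWithin_le_nhds
    refine tendsto_finsetSum _ fun i _ => ?_
    exact (hφ.continuous_comp_abs.tendsto _).comp
      (tendsto_const_nhds.div tendsto_id one_ne_zero)
  simp only [div_one] at hc
  exact le_of_tendsto hc (by filter_upwards [self_mem_nhdsWithin] with r h using hr r h)

theorem youngConj_le {u κ : ℝ} (h : ∀ t : ℝ, 0 < t → t * u - φ t ≤ κ) :
    youngConj φ u ≤ ENNReal.ofReal κ :=
  iSup_le fun t => ENNReal.ofReal_le_ofReal (h t t.2)

theorem youngConj_zero (hφ : IsOrliczFunction φ) : youngConj φ 0 = 0 := by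
  refine le_antisymm ?_ bot_le
  simpa using youngConj_le (φ := φ) (u := 0) (κ := 0) fun t ht => by
    have := hφ.nonneg ht.le
    linarith

theorem mul_sub_le_of_youngConj_le {u κ t : ℝ} (hκ : 0 ≤ κ) (ht : 0 < t)
    (h : youngConj φ u ≤ ENNReal.ofReal κ) : t * u - φ t ≤ κ := by
  have := (le_iSup (fun t : {t : ℝ // 0 < t} => ENNReal.ofReal (t * u - φ t)) ⟨t, ht⟩).trans h
  exact (ENNReal.ofReal_le_ofReal_iff hκ).1 this

theorem sum_mul_le (hφ : IsOrliczFunction φ) {x y : ι → ℝ} {r m : ℝ} (hr : 0 < r) (hm : 0 ≤ m)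
    (hx : orliczModular φ (fun i => x i / r) ≤ ENNReal.ofReal m)
    (hy : ∑' i, youngConj φ |y i| ≤ 1) (S : Finset ι) :
    ∑ i ∈ S, x i * y i ≤ r * (1 + m) := by
  have hfin : ∀ i, youngConj φ |y i| ≠ ⊤ := fun i =>
    ((ENNReal.le_tsum i).trans_lt (hy.trans_lt ENNReal.one_lt_top)).ne
  have h1 : ∑ i ∈ S, (youngConj φ |y i|).toReal ≤ 1 := by
    rw [← ENNReal.toReal_sum fun i _ => hfin i]
    exact ENNReal.toReal_le_of_le_ofReal zero_le_one
      (by simpa using (ENNReal.sum_le_tsum S).trans hy)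
  have h2 := hφ.sum_le_of_modular_le hm hx S
  have h3 : ∀ i ∈ S, x i * y i ≤ r * ((youngConj φ |y i|).toReal + φ |x i / r|) := by
    intro i _
    have h4 : |x i / r| * |y i| ≤ (youngConj φ |y i|).toReal + φ |x i / r| := by
      rcases (abs_nonneg (x i / r)).eq_or_lt with h0 | h0
      · rw [← h0, hφ.map_zero]; simp
      · linarith [mul_sub_le_of_youngConj_le ENNReal.toReal_nonneg h0
          (ENNReal.ofReal_toReal (hfin i)).ge]
    calc x i * y i = r * (x i / r * y i) := by field_simp
      _ ≤ r * (|x i / r| * |y i|) := by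
          rw [← abs_mul]; exact mul_le_mul_of_nonneg_left (le_abs_self _) hr.le
      _ ≤ _ := mul_le_mul_of_nonneg_left h4 hr.le
  refine (Finset.sum_le_sum h3).trans ?_
  rw [← Finset.mul_sum, Finset.sum_add_distrib]
  exact mul_le_mul_of_nonneg_left (add_le_add h1 h2) hr.le

theorem orliczNorm_le (hφ : IsOrliczFunction φ) {x : ι → ℝ} {m : ℝ} (hm : 0 ≤ m)
    (hx : orliczModular φ x ≤ ENNReal.ofReal m) : orliczNorm φ x ≤ 1 + m := by
  refine csSup_le ⟨0, 0, by simp [hφ.youngConj_zero], by simp⟩ ?_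
  rintro s ⟨y, hy, hs⟩
  refine hasSum_le_of_sum_le hs fun S => ?_
  simpa using hφ.sum_mul_le one_pos hm (by simpa using hx) hy S

theorem sum_mul_le_orliczNorm (hφ : IsOrliczFunction φ) (x : orliczSpace ι hφ) {S : Finset ι}
    {y κ : ι → ℝ} (hy : ∀ i ∈ S, youngConj φ |y i| ≤ ENNReal.ofReal (κ i))
    (hκ : ∀ i ∈ S, 0 ≤ κ i) (hS : ∑ i ∈ S, κ i ≤ 1) :
    ∑ i ∈ S, x.1 i * y i ≤ orliczNorm φ x.1 := by
  classical
  refine le_csSup ?_ ⟨fun i => if i ∈ S then y i else 0, ?_, ?_⟩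
  · obtain ⟨r, hr, hx⟩ := hφ.exists_modular_div_le_one x
    refine ⟨r * (1 + 1), ?_⟩
    rintro s ⟨y, hy, hs⟩
    exact hasSum_le_of_sum_le hs
      fun S => hφ.sum_mul_le hr zero_le_one (by simpa using hx) hy S
  · rw [tsum_eq_sum (s := S) fun i hi => by simp [hi, hφ.youngConj_zero]]
    rw [← ENNReal.ofReal_one]
    refine le_trans ?_ (ENNReal.ofReal_le_ofReal hS)
    rw [ENNReal.ofReal_sum_of_nonneg hκ]
    exact Finset.sum_le_sum fun i hi => by simpa [hi] using hy i hi
  · have := hasSum_sum_of_ne_finset_zero (L := SummationFilter.unconditional ι) (s := S)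
      (f := fun i => x.1 i * (if i ∈ S then y i else 0)) fun i hi => by simp [hi]
    rwa [Finset.sum_congr rfl fun i hi => by rw [if_pos hi]] at this

/-- Young's equality is attained with a prescribed value of the conjugate function. -/
theorem exists_conj_eq (hφ : IsOrliczFunction φ) (hfin : ∀ u : ℝ, 0 ≤ u → youngConj φ u < ⊤)
    {κ : ℝ} (hκ : 0 ≤ κ) :
    ∃ u c : ℝ, 0 ≤ u ∧ 0 ≤ c ∧ c * u = φ c + κ ∧ ∀ t : ℝ, 0 < t → t * u - φ t ≤ κ := by
  rcases hκ.eq_or_lt with rfl | hκ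
  · exact ⟨0, 0, le_rfl, le_rfl, by simp [hφ.map_zero], fun t ht => by
      linarith [hφ.nonneg ht.le]⟩
  -- The number u will be the minimum of (φ(t) + κ)/t over t > 0. Finiteness of the conjugate at 3 +
  -- κ keeps minimizers below M + 1, since the value 1 + κ is already reached at t = 1.
  set M := (youngConj φ (3 + κ)).toReal with hM
  have hM0 : 0 ≤ M := ENNReal.toReal_nonneg
  have hMt : ∀ t : ℝ, 0 < t → t * (3 + κ) - φ t ≤ M := fun t ht =>
    mul_sub_le_of_youngConj_le hM0 ht (ENNReal.ofReal_toReal (hfin _ (by positivity)).ne).ge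
  -- Below δ the term κ/t alone exceeds 1 + κ.
  set δ := κ / (1 + κ) with hδ
  have hδ0 : 0 < δ := by positivity
  have hδ1 : δ ≤ 1 := by rw [hδ, div_le_one (by positivity)]; linarith
  have hcont : ContinuousOn (fun t => (φ |t| + κ) / t) (Set.Icc δ (M + 1)) := by
    refine ContinuousOn.div ?_ continuousOn_id fun t ht => (hδ0.trans_le ht.1).ne'
    exact (hφ.continuous_comp_abs.add continuous_const).continuousOn
  have h1mem : (1 : ℝ) ∈ Set.Icc δ (M + 1) := ⟨hδ1, by linarith⟩
  obtain ⟨c, hc, hmin⟩ := isCompact_Icc.exists_isMinOn ⟨1, h1mem⟩ hcont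
  have hc0 : 0 < c := hδ0.trans_le hc.1
  have hmin' : ∀ t ∈ Set.Icc δ (M + 1), (φ c + κ) / c ≤ (φ t + κ) / t := fun t ht => by
    have := isMinOn_iff.1 hmin t ht
    simpa [abs_of_pos hc0, abs_of_pos (hδ0.trans_le ht.1)] using this
  have h1 : (φ c + κ) / c ≤ 1 + κ := by simpa [hφ.map_one] using hmin' 1 h1mem
  refine ⟨(φ c + κ) / c, c, ?_, hc0.le, by field_simp, fun t ht => ?_⟩
  · have := hφ.nonneg hc0.le
    positivity
  have hφt := hφ.nonneg ht.le
  have hle := mul_le_mul_of_nonneg_left h1 ht.le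
  rcases lt_or_ge t δ with h | h
  · have : t * (1 + κ) ≤ κ := by
      rw [hδ, lt_div_iff₀ (by positivity)] at h
      exact h.le
    linarith
  rcases le_or_gt t (M + 1) with h' | h'
  · have := mul_le_mul_of_nonneg_left (hmin' t ⟨h, h'⟩) ht.le
    rw [mul_div_cancel₀ _ ht.ne'] at this
    linarith
  · have := hMt t ht
    nlinarith

end IsOrliczFunction

/-- The vector of the Orlicz space with coordinates `z` on the finite set `S`, and `0` elsewhere. -/
noncomputable def finiteVector {ι : Type*} {φ : ℝ → ℝ} (hφ : IsOrliczFunction φ) (S : Finset ι)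
    (z : ι → ℝ) : orliczSpace ι hφ :=
  ∑ i ∈ S, z i • orliczBasisVector hφ i

/-! ### Supporting functionals and orthogonality to the range of `Q`. -/

namespace IsOrliczFunction

variable {φ : ℝ → ℝ} {ι : Type*}

open Classical in
theorem orliczBasisVector_apply (hφ : IsOrliczFunction φ) (i j : ι) :
    (orliczBasisVector hφ i).1 j = if j = i then 1 else 0 := by
  simp [orliczBasisVector, Pi.single_apply]

open Classical in
theorem finiteVector_apply (hφ : IsOrliczFunction φ) (S : Finset ι) (z : ι → ℝ) (j : ι) :
    (finiteVector hφ S z).1 j = if j ∈ S then z j else 0 := by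
  simp [finiteVector, Finset.sum_apply, orliczBasisVector_apply]

theorem finiteVector_add (hφ : IsOrliczFunction φ) (S : Finset ι) (y z : ι → ℝ) :
    finiteVector hφ S (y + z) = finiteVector hφ S y + finiteVector hφ S z := by
  simp [finiteVector, add_smul, Finset.sum_add_distrib]

theorem finiteVector_smul (hφ : IsOrliczFunction φ) (S : Finset ι) (c : ℝ) (z : ι → ℝ) :
    finiteVector hφ S (c • z) = c • finiteVector hφ S z := by
  simp [finiteVector, Finset.smul_sum, mul_smul]

open Classical in
theorem finiteVector_insert_update (hφ : IsOrliczFunction φ) {S : Finset ι} {o : ι} (ho : o ∉ S)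
    (z : ι → ℝ) (c : ℝ) :
    finiteVector hφ (insert o S) (Function.update z o c) =
      c • orliczBasisVector hφ o + finiteVector hφ S z := by
  unfold finiteVector
  rw [Finset.sum_insert ho, Function.update_self]
  congr 1
  refine Finset.sum_congr rfl fun i hi => ?_
  rw [Function.update_of_ne (ne_of_mem_of_not_mem hi ho)]

theorem modular_finiteVector (hφ : IsOrliczFunction φ) (S : Finset ι) (z : ι → ℝ) :
    orliczModular φ (finiteVector hφ S z).1 = ENNReal.ofReal (∑ i ∈ S, φ |z i|) := by
  classical
  rw [hφ.modular_of_support_subset S fun i hi => by simp [finiteVector_apply, hi]]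
  congr 1
  refine Finset.sum_congr rfl fun i hi => ?_
  rw [finiteVector_apply, if_pos hi]

variable {N : (ι → ℝ) → ℝ}

/-- The modular of X is 1, so that of X - QX is at most 1; the subgradient inequalities summed over
S compare the two. -/
theorem sum_subgradient_nonneg_luxemburg (hφ : IsOrliczFunction φ)
    {Q : orliczSpace ι hφ →ₗ[ℝ] orliczSpace ι hφ}
    (hQ : ∀ x, luxemburgNorm φ (x - Q x).1 ≤ luxemburgNorm φ x.1) (S : Finset ι) (x y : ι → ℝ)
    (hxy : ∀ i ∈ S, ∀ b, φ |x i| + y i * (b - x i) ≤ φ |b|) (hx : ∑ i ∈ S, φ |x i| = 1) :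
    0 ≤ ∑ i ∈ S, y i * (Q (finiteVector hφ S x)).1 i := by
  classical
  set X := finiteVector hφ S x
  have h1 : luxemburgNorm φ X.1 ≤ 1 := luxemburgNorm_le_one (by
    rw [modular_finiteVector, hx, ENNReal.ofReal_one])
  have h2 := hφ.sum_le_one_of_luxemburgNorm_le_one _ ((hQ X).trans h1) S
  have h3 : ∀ i ∈ S, φ |x i| - y i * (Q X).1 i ≤ φ |(X - Q X).1 i| := by
    intro i hi
    have h4 := hxy i hi ((X - Q X).1 i)
    have h5 : (X - Q X).1 i = x i - (Q X).1 i := by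
      simp [X, finiteVector_apply, hi]
    rw [h5] at h4 ⊢
    linarith
  have h4 := (Finset.sum_le_sum h3).trans h2
  rw [Finset.sum_sub_distrib, hx] at h4
  linarith

/-- By equality in Young's inequality y pairs with X to 1 + Σ φ(|x_i|), an upper bound for the norm
of X, while y is admissible in the supremum defining the norm of X - QX. -/
theorem sum_subgradient_nonneg_orlicz (hφ : IsOrliczFunction φ)
    {Q : orliczSpace ι hφ →ₗ[ℝ] orliczSpace ι hφ}
    (hQ : ∀ x, orliczNorm φ (x - Q x).1 ≤ orliczNorm φ x.1) (S : Finset ι) (x y κ : ι → ℝ)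
    (hy : ∀ i ∈ S, youngConj φ |y i| ≤ ENNReal.ofReal (κ i))
    (hκ : ∀ i ∈ S, 0 ≤ κ i) (hS : ∑ i ∈ S, κ i = 1)
    (hxy : ∀ i ∈ S, x i * y i = φ |x i| + κ i) :
    0 ≤ ∑ i ∈ S, y i * (Q (finiteVector hφ S x)).1 i := by
  classical
  set X := finiteVector hφ S x
  have h1 := hφ.orliczNorm_le (Finset.sum_nonneg fun i _ => hφ.nonneg (abs_nonneg _))
    (hφ.modular_finiteVector S x).le
  have h2 := hφ.sum_mul_le_orliczNorm (X - Q X) hy hκ hS.le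
  have h3 : ∑ i ∈ S, (X - Q X).1 i * y i
      = ∑ i ∈ S, φ |x i| + 1 - ∑ i ∈ S, y i * (Q X).1 i := by
    rw [← hS, ← Finset.sum_add_distrib, ← Finset.sum_sub_distrib]
    refine Finset.sum_congr rfl fun i hi => ?_
    rw [← hxy i hi]
    have h5 : (X - Q X).1 i = x i - (Q X).1 i := by
      simp [X, finiteVector_apply, hi]
    rw [h5]; ring
  have := hQ X
  linarith

/-- The coordinate o supplies what is missing to modular 1 (Luxemburg) or to dual modular 1
(Orlicz). Both signs of that coordinate are allowed and Q ignores it, so its contribution cancels on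
averaging. -/
theorem sum_oddRightDeriv_nonneg (hφ : IsOrliczFunction φ)
    (hN : N = luxemburgNorm φ ∨ (N = orliczNorm φ ∧ ∀ u : ℝ, 0 ≤ u → youngConj φ u < ⊤))
    {Q : orliczSpace ι hφ →ₗ[ℝ] orliczSpace ι hφ} (hQ : ∀ x, N (x - Q x).1 ≤ N x.1)
    {o : ι} (ho : Q (orliczBasisVector hφ o) = 0) {S : Finset ι} (hoS : o ∉ S) (z : ι → ℝ)
    (hz : ∑ i ∈ S, φ |2 * z i| ≤ 1) :
    0 ≤ ∑ i ∈ S, oddRightDeriv φ (z i) * (Q (finiteVector hφ S z)).1 i := by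
  classical
  suffices ∃ c u : ℝ, ∀ σ : ℝ, |σ| = 1 →
      0 ≤ ∑ i ∈ insert o S, Function.update (fun i => oddRightDeriv φ (z i)) o (σ * u) i *
        (Q (finiteVector hφ (insert o S) (Function.update z o (σ * c)))).1 i by
    obtain ⟨c, u, h⟩ := this
    have key : ∀ σ : ℝ, |σ| = 1 → 0 ≤ σ * u * (Q (finiteVector hφ S z)).1 o +
        ∑ i ∈ S, oddRightDeriv φ (z i) * (Q (finiteVector hφ S z)).1 i := by
      intro σ hσ
      have := h σ hσ
      rw [finiteVector_insert_update hφ hoS, map_add, map_smul, ho, smul_zero, zero_add,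
        Finset.sum_insert hoS, Function.update_self] at this
      refine this.trans_eq (congrArg _ (Finset.sum_congr rfl fun i hi => ?_))
      rw [Function.update_of_ne (ne_of_mem_of_not_mem hi hoS)]
    have h1 := key 1 (by simp)
    have h2 := key (-1) (by simp)
    linarith
  rcases hN with rfl | ⟨rfl, hfin⟩
  · have hle : ∑ i ∈ S, φ |z i| ≤ 1 := by
      refine le_trans (Finset.sum_le_sum fun i _ => ?_) hz
      refine hφ.monotone (Set.mem_Ici.2 (abs_nonneg _)) (Set.mem_Ici.2 (abs_nonneg _)) ?_
      rw [abs_mul, abs_two]; linarith [abs_nonneg (z i)]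
    obtain ⟨c, hc, hc'⟩ := hφ.exists_eq (sub_nonneg.2 hle)
      (sub_le_self _ (Finset.sum_nonneg fun i _ => hφ.nonneg (abs_nonneg _)))
    refine ⟨c, oddRightDeriv φ c, fun σ hσ => ?_⟩
    have hσ' : σ * oddRightDeriv φ c = oddRightDeriv φ (σ * c) := by
      rcases eq_or_eq_neg_of_abs_eq hσ with rfl | rfl <;> simp [oddRightDeriv_neg]
    refine hφ.sum_subgradient_nonneg_luxemburg hQ _ _ _ (fun i hi b => ?_) ?_
    · rcases eq_or_ne i o with rfl | hio
      · simp only [Function.update_self, hσ']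
        exact hφ.subgradient _ _
      · simp only [Function.update_of_ne hio]
        exact hφ.subgradient _ _
    · have he : ∑ i ∈ S, φ |Function.update z o (σ * c) i| = ∑ i ∈ S, φ |z i| :=
        Finset.sum_congr rfl fun i hi => by
          rw [Function.update_of_ne (ne_of_mem_of_not_mem hi hoS)]
      rw [Finset.sum_insert hoS, Function.update_self, abs_mul, hσ, one_mul, abs_of_nonneg hc, hc',
        he, sub_add_cancel]
  · have hle : ∑ i ∈ S, (oddRightDeriv φ (z i) * z i - φ |z i|) ≤ 1 :=
      (Finset.sum_le_sum fun i _ => hφ.oddRightDeriv_mul_self_sub_le _).trans hz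
    obtain ⟨u, c, hu, hc, huc, hut⟩ := hφ.exists_conj_eq hfin (sub_nonneg.2 hle)
    refine ⟨c, u, fun σ hσ => ?_⟩
    refine hφ.sum_subgradient_nonneg_orlicz hQ _ _ _
      (Function.update (fun i => oddRightDeriv φ (z i) * z i - φ |z i|) o
        (1 - ∑ i ∈ S, (oddRightDeriv φ (z i) * z i - φ |z i|))) ?_ ?_ ?_ ?_
    · intro i hi
      rcases eq_or_ne i o with rfl | hio
      · simp only [Function.update_self, abs_mul, hσ, one_mul, abs_of_nonneg hu]
        exact youngConj_le hut
      · simp only [Function.update_of_ne hio]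
        exact youngConj_le fun t ht => hφ.mul_oddRightDeriv_sub_le _ ht.le
    · intro i hi
      rcases eq_or_ne i o with rfl | hio
      · simpa only [Function.update_self] using sub_nonneg.2 hle
      · simp only [Function.update_of_ne hio]
        simpa [hφ.map_zero] using hφ.mul_oddRightDeriv_sub_le (z i) le_rfl
    · rw [Finset.sum_insert hoS, Function.update_self, Finset.sum_update_of_notMem hoS,
        sub_add_cancel]
    · intro i hi
      rcases eq_or_ne i o with rfl | hio
      · simp only [Function.update_self, abs_mul, hσ, one_mul, abs_of_nonneg hc, ← huc]
        have : σ * σ = 1 := by rw [← abs_mul_abs_self, hσ, one_mul]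
        linear_combination c * u * this
      · simp only [Function.update_of_ne hio]
        ring

/-- On small vectors annihilated by `Q`, the right derivative is orthogonal to the range of `Q`. -/
theorem sum_oddRightDeriv_eq_zero (hφ : IsOrliczFunction φ)
    (hN : N = luxemburgNorm φ ∨ (N = orliczNorm φ ∧ ∀ u : ℝ, 0 ≤ u → youngConj φ u < ⊤))
    {Q : orliczSpace ι hφ →ₗ[ℝ] orliczSpace ι hφ} (hQ : ∀ x, N (x - Q x).1 ≤ N x.1)
    {o : ι} (ho : Q (orliczBasisVector hφ o) = 0) {S : Finset ι} (hoS : o ∉ S) {x h : ι → ℝ}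
    (hx : Q (finiteVector hφ S x) = 0) (hh : ∀ i, x i = 0 → h i = 0)
    (hxS : ∑ i ∈ S, φ |2 * x i| < 1) :
    ∑ i ∈ S, oddRightDeriv φ (x i) * (Q (finiteVector hφ S h)).1 i = 0 := by
  -- With ε this small, x ± ε h has the signs of x, so adding s(x ± ε h) moves every nonzero
  -- coordinate away from 0, where φ' is one-sidedly continuous.
  obtain ⟨ε, hε, hεx⟩ : ∃ ε > 0, ∀ i ∈ S, ∀ σ : ℝ, |σ| = 1 → x i ≠ 0 →
      0 < x i * (x i + σ * ε * h i) := by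
    have : ∀ᶠ ε : ℝ in 𝓝[>] 0, ∀ i ∈ S, ε * |h i| < |x i| ∨ x i = 0 := by
      rw [Finset.eventually_all]
      intro i _
      rcases eq_or_ne (x i) 0 with h0 | h0
      · simp [h0]
      · have hc : Continuous fun ε : ℝ => ε * |h i| := by fun_prop
        have := (hc.tendsto 0).eventually_lt_const (u := |x i|) (by simpa using h0)
        filter_upwards [nhdsWithin_le_nhds this] with ε hε using Or.inl hε
    obtain ⟨ε, hε, hε0⟩ := (this.and self_mem_nhdsWithin).exists
    refine ⟨ε, hε0, fun i hi σ hσ h0 => ?_⟩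
    have h1 := (hε i hi).resolve_right h0
    have h2 : |x i * (σ * ε * h i)| < x i * x i := by
      rw [abs_mul, abs_mul, abs_mul, hσ, one_mul, abs_of_pos (show 0 < ε from hε0),
        ← abs_mul_abs_self (x i)]
      exact mul_lt_mul_of_pos_left h1 (abs_pos.2 h0)
    have := neg_lt_of_abs_lt h2
    linarith
  have key : ∀ σ : ℝ, |σ| = 1 →
      0 ≤ σ * ∑ i ∈ S, oddRightDeriv φ (x i) * (Q (finiteVector hφ S h)).1 i := by
    intro σ hσ
    set z : ℝ → ι → ℝ := fun s i => x i + s * (x i + σ * ε * h i) with hz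
    -- As Qx = 0, only h survives; dividing by s > 0 and letting s → 0 leaves an inequality for each
    -- sign σ.
    have hvec : ∀ s, Q (finiteVector hφ S (z s)) = (s * (σ * ε)) • Q (finiteVector hφ S h) := by
      intro s
      have : z s = (1 + s) • x + (s * (σ * ε)) • h := by
        ext i; simp [hz]; ring
      rw [this, finiteVector_add, finiteVector_smul, finiteVector_smul, map_add, map_smul,
        map_smul, hx, smul_zero, zero_add]
    have hev : ∀ᶠ s : ℝ in 𝓝[>] 0,
        0 ≤ ∑ i ∈ S, oddRightDeriv φ (z s i) * (Q (finiteVector hφ S h)).1 i * (σ * ε) := by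
      have hsmall : ∀ᶠ s : ℝ in 𝓝 0, ∑ i ∈ S, φ |2 * z s i| < 1 := by
        have hc : Continuous fun s : ℝ => ∑ i ∈ S, φ |2 * z s i| := by
          refine continuous_finsetSum _ fun i _ => ?_
          exact hφ.continuous_comp_abs.comp
            (by simp only [hz]; fun_prop : Continuous fun s : ℝ => 2 * z s i)
        exact (hc.tendsto 0).eventually_lt_const (by simpa [hz] using hxS)
      filter_upwards [nhdsWithin_le_nhds hsmall, self_mem_nhdsWithin] with s hs hs0
      have := hφ.sum_oddRightDeriv_nonneg hN hQ ho hoS (z s) hs.le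
      rw [hvec] at this
      refine nonneg_of_mul_nonneg_right (a := s) (this.trans_eq ?_) hs0
      rw [Finset.mul_sum]
      refine Finset.sum_congr rfl fun i _ => ?_
      simp only [Submodule.coe_smul, Pi.smul_apply, smul_eq_mul]
      ring
    have hlim : Tendsto (fun s : ℝ =>
        ∑ i ∈ S, oddRightDeriv φ (z s i) * (Q (finiteVector hφ S h)).1 i * (σ * ε)) (𝓝[>] 0)
        (𝓝 (∑ i ∈ S, oddRightDeriv φ (x i) * (Q (finiteVector hφ S h)).1 i * (σ * ε))) := by
      refine tendsto_finsetSum _ fun i hi => ?_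
      refine Tendsto.mul_const _ (Tendsto.mul_const _ ?_)
      rcases eq_or_ne (x i) 0 with h0 | h0
      · simp [hz, h0, hh i h0]
      · exact hφ.tendsto_oddRightDeriv_add_mul (hεx i hi σ hσ h0)
    have := ge_of_tendsto hlim hev
    rw [← Finset.sum_mul] at this
    refine nonneg_of_mul_nonneg_right (a := ε) (this.trans_eq (by ring)) hε
  have h1 := key 1 (by simp)
  have h2 := key (-1) (by simp)
  linarith

/-- This is the integral of the orthogonality relation along τx, 0 ≤ τ ≤ 1. The gain is that
φ(|t|)/t is continuous off 0 whereas φ' need not be. Coordinates with x_i = 0 contribute 0, by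
division by zero. -/
theorem sum_div_eq_zero (hφ : IsOrliczFunction φ)
    (hN : N = luxemburgNorm φ ∨ (N = orliczNorm φ ∧ ∀ u : ℝ, 0 ≤ u → youngConj φ u < ⊤))
    {Q : orliczSpace ι hφ →ₗ[ℝ] orliczSpace ι hφ} (hQ : ∀ x, N (x - Q x).1 ≤ N x.1)
    {o : ι} (ho : Q (orliczBasisVector hφ o) = 0) {S : Finset ι} (hoS : o ∉ S) {x h : ι → ℝ}
    (hx : Q (finiteVector hφ S x) = 0) (hh : ∀ i, x i = 0 → h i = 0)
    (hxS : ∑ i ∈ S, φ |2 * x i| < 1) :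
    ∑ i ∈ S, φ |x i| / x i * (Q (finiteVector hφ S h)).1 i = 0 := by
  set w := fun i => (Q (finiteVector hφ S h)).1 i
  set f : ℝ → ℝ := fun τ => ∑ i ∈ S, φ |τ * x i| / x i * w i with hf
  have hfc : Continuous f := by
    refine continuous_finsetSum _ fun i _ => ?_
    refine Continuous.mul (Continuous.div_const ?_ _) continuous_const
    exact hφ.continuous_comp_abs.comp (continuous_mul_const (x i))
  -- The right derivative along the ray is computed only for τ > 0, so constancy is proved on [a, 1]
  -- and a tends to 0 afterwards.
  have hconst : ∀ a ∈ Set.Ioo (0 : ℝ) 1, f 1 = f a := by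
    intro a ha
    refine constant_of_has_deriv_right_zero (b := 1) hfc.continuousOn (fun τ hτ => ?_) 1
      ⟨ha.2.le, le_rfl⟩
    have hτ0 : 0 < τ := ha.1.trans_le hτ.1
    have hder : HasDerivWithinAt f (∑ i ∈ S, oddRightDeriv φ (τ * x i) * w i) (Set.Ici τ) τ := by
      refine HasDerivWithinAt.fun_sum fun i _ => ?_
      rcases eq_or_ne (x i) 0 with h0 | h0
      · simpa [h0, oddRightDeriv_zero] using hasDerivWithinAt_const τ (Set.Ici τ) (0 : ℝ)
      · have := ((hφ.hasDerivWithinAt_ray hτ0 h0).div_const (x i)).mul_const (w i)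
        rwa [mul_div_cancel_right₀ _ h0] at this
    suffices he : ∑ i ∈ S, oddRightDeriv φ (τ * x i) * w i = 0 by rwa [he] at hder
    refine hφ.sum_oddRightDeriv_eq_zero hN hQ ho hoS (x := τ • x) (h := h) ?_ ?_ ?_
    · rw [finiteVector_smul, map_smul, hx, smul_zero]
    · intro i hi
      exact hh i (by simpa [hτ0.ne'] using hi)
    · refine lt_of_le_of_lt (Finset.sum_le_sum fun i _ => ?_) hxS
      refine hφ.monotone (Set.mem_Ici.2 (abs_nonneg _)) (Set.mem_Ici.2 (abs_nonneg _)) ?_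
      simp only [Pi.smul_apply, smul_eq_mul, abs_mul, abs_two, abs_of_pos hτ0]
      have := mul_le_of_le_one_left (abs_nonneg (x i)) hτ.2.le
      linarith
  have hlim : Tendsto f (𝓝[>] 0) (𝓝 (f 0)) := (hfc.tendsto 0).mono_left nhdsWithin_le_nhds
  have hlim' : Tendsto f (𝓝[>] 0) (𝓝 (f 1)) := by
    refine tendsto_const_nhds.congr' ?_
    filter_upwards [Ioo_mem_nhdsGT (zero_lt_one' ℝ)] with a ha using hconst a ha
  have h01 := tendsto_nhds_unique hlim' hlim
  simpa [hf, hφ.map_zero] using h01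

end IsOrliczFunction

/-! ### From finite truncations to arbitrary vectors. -/

namespace IsOrliczFunction

variable {φ : ℝ → ℝ} {ι : Type*} {N : (ι → ℝ) → ℝ}

theorem finiteVector_sub_apply (hφ : IsOrliczFunction φ) (v : orliczSpace ι hφ) {A : Finset ι}
    {i : ι} (hi : i ∈ A) : (v - finiteVector hφ A v.1).1 i = 0 := by
  classical
  simp [finiteVector_apply, hi]

theorem exists_forall_modular_tail_le (hφ : IsOrliczFunction φ) (v : orliczSpace ι hφ)
    (hv : orliczModular φ v.1 < ∞) {δ : ℝ} (hδ : 0 < δ) :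
    ∃ S : Finset ι, ∀ A, S ⊆ A →
      orliczModular φ (v - finiteVector hφ A v.1).1 ≤ ENNReal.ofReal δ := by
  classical
  have h1 := ENNReal.tendsto_tsum_compl_atTop_zero hv.ne
  have h2 := h1.eventually_le_const (ENNReal.ofReal_pos.2 hδ)
  obtain ⟨S, hS⟩ := eventually_atTop.1 h2
  refine ⟨S, fun A hA => le_trans (le_of_eq ?_) (hS A hA)⟩
  unfold orliczModular
  have h3 := tsum_subtype (fun i => i ∉ A) (fun i => ENNReal.ofReal (φ |v.1 i|))
  refine Eq.trans (tsum_congr fun i => ?_) h3.symm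
  by_cases hi : i ∈ A
  · have := Set.indicator_of_notMem (s := fun i => i ∉ A) (a := i) (fun h => h hi)
      (fun i => ENNReal.ofReal (φ |v.1 i|))
    rw [this, finiteVector_sub_apply hφ v hi]
    simp [hφ.map_zero]
  · have := Set.indicator_of_mem (s := fun i => i ∉ A) (a := i) hi
      (fun i => ENNReal.ofReal (φ |v.1 i|))
    rw [this]
    simp [finiteVector_apply, hi]

theorem modular_smul_add_le (hφ : IsOrliczFunction φ) (x : orliczSpace ι hφ) {o : ι}
    (hxo : x.1 o = 0) {c m : ℝ} (hc : 0 ≤ c) (hm : 0 ≤ m)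
    (hx : orliczModular φ x.1 ≤ ENNReal.ofReal m) {σ : ℝ} (hσ : |σ| = 1) :
    orliczModular φ ((σ * c) • orliczBasisVector hφ o + x).1 ≤ ENNReal.ofReal (φ c + m) := by
  classical
  rw [ENNReal.ofReal_add (hφ.nonneg hc) hm]
  refine le_trans ?_ (add_le_add_right hx _)
  unfold orliczModular
  rw [← tsum_ite_eq o (fun _ => ENNReal.ofReal (φ c)), ← ENNReal.tsum_add]
  refine ENNReal.tsum_le_tsum fun i => ?_
  rcases eq_or_ne i o with rfl | hio
  · simp [orliczBasisVector_apply, hxo, abs_mul, hσ, abs_of_nonneg hc]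
  · simp [orliczBasisVector_apply, hio]

/-- Tails x of v have arbitrarily small modular yet Qx = Qv. Adding ±c e_o nearly exhausts the unit
modular, primal or dual, so contractivity leaves almost no room for the coordinate i of Qv;
averaging over the sign removes the coordinate o. -/
theorem coord_eq_zero_of_tail (hφ : IsOrliczFunction φ) (hpos : ∀ t : ℝ, 0 < t → 0 < φ t)
    (hN : N = luxemburgNorm φ ∨ (N = orliczNorm φ ∧ ∀ u : ℝ, 0 ≤ u → youngConj φ u < ⊤))
    {Q : orliczSpace ι hφ →ₗ[ℝ] orliczSpace ι hφ} (hQ : ∀ x, N (x - Q x).1 ≤ N x.1)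
    {o : ι} (ho : Q (orliczBasisVector hφ o) = 0) {v : orliczSpace ι hφ}
    (hv : orliczModular φ v.1 < ∞)
    (hvA : ∀ S : Finset ι, ∃ A, S ⊆ A ∧ Q (finiteVector hφ A v.1) = 0) {i : ι} (hio : i ≠ o) :
    (Q v).1 i = 0 := by
  classical
  have key : ∀ m : ℝ, 0 < m → ∃ x : orliczSpace ι hφ, x.1 o = 0 ∧ x.1 i = 0 ∧ Q x = Q v ∧
      orliczModular φ x.1 ≤ ENNReal.ofReal m := by
    intro m hm
    obtain ⟨S, hS⟩ := hφ.exists_forall_modular_tail_le v hv hm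
    obtain ⟨A, hA, hQA⟩ := hvA (S ∪ {o, i})
    refine ⟨v - finiteVector hφ A v.1, finiteVector_sub_apply hφ v (hA (by simp)),
      finiteVector_sub_apply hφ v (hA (by simp)), by rw [map_sub, hQA, sub_zero],
      hS A (Finset.union_subset_left hA)⟩
  set w := (Q v).1 with hw
  rcases hN with rfl | ⟨rfl, hfin⟩
  · have hle : ∀ δ : ℝ, 0 < δ → δ ≤ 1 → φ |w i| ≤ δ := by
      intro δ hδ hδ1
      obtain ⟨x, hxo, hxi, hxQ, hx⟩ := key δ hδ
      obtain ⟨c, hc, hc'⟩ := hφ.exists_eq (sub_nonneg.2 hδ1) (sub_le_self _ hδ.le)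
      have h1 : ∀ σ : ℝ, |σ| = 1 → φ |σ * c - w o| + φ |w i| ≤ 1 := by
        intro σ hσ
        set X := (σ * c) • orliczBasisVector hφ o + x with hX
        have hQX : Q X = Q v := by rw [hX, map_add, map_smul, ho, smul_zero, zero_add, hxQ]
        have h2 : luxemburgNorm φ X.1 ≤ 1 := luxemburgNorm_le_one (by
          have := hφ.modular_smul_add_le x hxo hc hδ.le hx hσ
          rwa [hc', sub_add_cancel, ENNReal.ofReal_one] at this)
        have h3 := hφ.sum_le_one_of_luxemburgNorm_le_one _ ((hQ X).trans h2) {o, i}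
        rw [Finset.sum_pair hio.symm, hQX] at h3
        have e1 : (X - Q v).1 o = σ * c - w o := by
          simp [hX, orliczBasisVector_apply, hxo, hw]
        have e2 : (X - Q v).1 i = -w i := by
          simp [hX, orliczBasisVector_apply, hxi, hw, hio]
        rwa [e1, e2, abs_neg] at h3
      have h2 := h1 1 (by simp)
      have h3 := h1 (-1) (by simp)
      have h4 := hφ.convexOn_comp_abs.2 (Set.mem_univ (1 * c - w o))
        (Set.mem_univ (-(-1 * c - w o))) (by norm_num : (0 : ℝ) ≤ 1 / 2)
        (by norm_num : (0 : ℝ) ≤ 1 / 2) (by norm_num)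
      have e : (1 / 2 : ℝ) * (1 * c - w o) + 1 / 2 * (-(-1 * c - w o)) = c := by ring
      simp only [smul_eq_mul, e] at h4
      rw [abs_neg, abs_of_nonneg hc, hc'] at h4
      linarith
    by_contra hne
    have hp := hpos _ (abs_pos.2 hne)
    have := hle (min (φ |w i| / 2) 1) (lt_min (by linarith) one_pos) (min_le_right _ _)
    linarith [min_le_left (φ |w i| / 2) 1]
  · have hle : ∀ δ : ℝ, 0 < δ → δ ≤ 1 → |w i| ≤ 2 * δ := by
      intro δ hδ hδ1
      -- A dual weight η at i whose conjugate value is at most δη: the dual cost is then small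
      -- relative to η itself.
      set η := min (φ δ / δ) 1 with hη
      have hη0 : 0 < η := lt_min (div_pos (hpos δ hδ) hδ) one_pos
      have hηc : youngConj φ η ≤ ENNReal.ofReal (δ * η) := by
        refine youngConj_le fun t ht => ?_
        rcases le_total t δ with h | h
        · have := hφ.nonneg ht.le
          nlinarith
        · have h1 := hφ.mul_le (a := δ / t) (by positivity) (by rwa [div_le_one ht]) ht.le
          rw [div_mul_cancel₀ _ ht.ne'] at h1
          have h2 : t * η ≤ t * (φ δ / δ) := mul_le_mul_of_nonneg_left (min_le_left _ _) ht.le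
          have h3 : t * (φ δ / δ) ≤ φ t := by
            rw [← mul_div_assoc, div_le_iff₀ hδ]
            have := mul_le_mul_of_nonneg_left h1 ht.le
            have e : t * (δ / t * φ t) = φ t * δ := by field_simp
            linarith
          have : 0 ≤ δ * η := by positivity
          linarith
      have hδη : δ * η ≤ 1 := by
        have : η ≤ 1 := min_le_right _ _
        nlinarith
      obtain ⟨u, c, hu, hc, huc, hut⟩ := hφ.exists_conj_eq hfin (sub_nonneg.2 hδη)
      obtain ⟨x, hxo, hxi, hxQ, hx⟩ := key (δ * η) (by positivity)
      have h1 : ∀ σ : ℝ, |σ| = 1 →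
          (σ * c - w o) * (σ * u) + η * |w i| ≤ 1 + (φ c + δ * η) := by
        intro σ hσ
        set X := (σ * c) • orliczBasisVector hφ o + x with hX
        have hQX : Q X = Q v := by rw [hX, map_add, map_smul, ho, smul_zero, zero_add, hxQ]
        have h2 := hφ.orliczNorm_le (by have := hφ.nonneg hc; positivity)
          (hφ.modular_smul_add_le x hxo hc (by positivity) hx hσ)
        have h3 := hφ.sum_mul_le_orliczNorm (X - Q X) (S := {o, i})
          (y := fun j => if j = o then σ * u else -(SignType.sign (w i) : ℝ) * η)
          (κ := fun j => if j = o then 1 - δ * η else δ * η) ?_ ?_ ?_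
        · rw [Finset.sum_pair hio.symm, hQX] at h3
          have e1 : (X - Q v).1 o = σ * c - w o := by
            simp [hX, orliczBasisVector_apply, hxo, hw]
          have e2 : (X - Q v).1 i = -w i := by
            simp [hX, orliczBasisVector_apply, hxi, hw, hio]
          rw [e1, e2, if_pos rfl, if_neg hio] at h3
          have h4 := hQ X
          rw [hQX] at h4
          have e3 : -w i * (-(SignType.sign (w i) : ℝ) * η) = η * |w i| := by
            rw [← sign_mul_self (w i)]; ring
          rw [e3] at h3
          linarith
        · intro j hj
          rcases eq_or_ne j o with rfl | hjo
          · simp only [if_true, abs_mul, hσ, one_mul, abs_of_nonneg hu]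
            exact youngConj_le hut
          · simp only [if_neg hjo]
            rcases eq_or_ne (w i) 0 with h0 | h0
            · simp [h0, hφ.youngConj_zero]
            · have : |(SignType.sign (w i) : ℝ)| = 1 := by
                rcases h0.lt_or_gt with h | h <;> simp [h]
              rwa [abs_mul, abs_neg, this, one_mul, abs_of_pos hη0]
        · intro j hj
          split_ifs
          · linarith
          · positivity
        · rw [Finset.sum_pair hio.symm, if_pos rfl, if_neg hio]
          linarith
      have h2 := h1 1 (by simp)
      have h3 := h1 (-1) (by simp)
      have h4 : η * |w i| ≤ η * (2 * δ) := by linarith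
      exact le_of_mul_le_mul_left h4 hη0
    by_contra hne
    have hp := abs_pos.2 hne
    have := hle (min (|w i| / 4) 1) (lt_min (by linarith) one_pos) (min_le_right _ _)
    linarith [min_le_left (|w i| / 4) 1]

/-- A vector is annihilated by `Q = 1 - P`, for a contractive projection `P`, as soon as cofinally
many of its finite truncations are. -/
theorem eq_zero_of_truncations (hφ : IsOrliczFunction φ) (hpos : ∀ t : ℝ, 0 < t → 0 < φ t)
    (hN : N = luxemburgNorm φ ∨ (N = orliczNorm φ ∧ ∀ u : ℝ, 0 ≤ u → youngConj φ u < ⊤))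
    {Q : orliczSpace ι hφ →ₗ[ℝ] orliczSpace ι hφ} (hQ : ∀ x, N (x - Q x).1 ≤ N x.1)
    (hQQ : ∀ x, Q (Q x) = Q x)
    {o : ι} (ho : Q (orliczBasisVector hφ o) = 0) {v : orliczSpace ι hφ}
    (hvA : ∀ S : Finset ι, ∃ A, S ⊆ A ∧ Q (finiteVector hφ A v.1) = 0) : Q v = 0 := by
  classical
  obtain ⟨r, hr, hrv⟩ := v.2
  have e : (fun i => v.1 i / r) = (r⁻¹ • v).1 := by
    ext i; simp [div_eq_inv_mul]
  rw [e] at hrv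
  have h1 : ∀ i, i ≠ o → (Q v).1 i = 0 := by
    intro i hi
    have := hφ.coord_eq_zero_of_tail hpos hN hQ ho hrv (fun S => ?_) hi
    · simpa [hr.ne'] using this
    · obtain ⟨A, hA, hQA⟩ := hvA S
      refine ⟨A, hA, ?_⟩
      have := hφ.finiteVector_smul A r⁻¹ v.1
      rw [Submodule.coe_smul, this, map_smul, hQA, smul_zero]
  -- Only the coordinate o could survive, and a multiple of e_o in the range of the projection Q is
  -- 0 because Q e_o = 0.
  have h2 : Q v = (Q v).1 o • orliczBasisVector hφ o := by
    ext i
    rcases eq_or_ne i o with rfl | hi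
    · simp [orliczBasisVector_apply]
    · simp [orliczBasisVector_apply, hi, h1 i hi]
  have h3 := hQQ v
  rw [h2, map_smul, ho, smul_zero] at h3
  rw [h2, ← h3]

end IsOrliczFunction

/-! ### Functional equations for φ(t)/t. -/

namespace IsOrliczFunction

variable {φ : ℝ → ℝ}

theorem div_self_mono (hφ : IsOrliczFunction φ) {s t : ℝ} (hs : 0 < s) (hst : s ≤ t) :
    φ s / s ≤ φ t / t := by
  have ht := hs.trans_le hst
  have := hφ.mul_le (a := s / t) (by positivity) (by rwa [div_le_one ht]) ht.le
  rw [div_mul_cancel₀ _ ht.ne'] at this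
  rw [div_le_iff₀ hs]
  exact this.trans_eq (by ring)

/-- φ(t)/t is additive near 0, and nondecreasing by convexity; a monotone additive function is
linear. -/
theorem similarToPow_two_of_additive (hφ : IsOrliczFunction φ)
    (hpos : ∀ t : ℝ, 0 < t → 0 < φ t) {δ : ℝ} (hδ : 0 < δ)
    (h : ∀ s t : ℝ, 0 < s → 0 < t → s + t < δ → φ (s + t) / (s + t) = φ s / s + φ t / t) :
    SimilarToPow φ 2 := by
  have hn : ∀ n : ℕ, ∀ u : ℝ, 0 < u → (n + 1) * u < δ →
      φ ((n + 1) * u) / ((n + 1) * u) = (n + 1) * (φ u / u) := by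
    intro n u hu
    induction n with
    | zero => simp
    | succ n ih =>
      intro hlt
      push_cast at hlt ⊢
      have h1 := h ((n + 1) * u) u (by positivity) hu (by linarith)
      rw [ih (by linarith)] at h1
      have e : ((n : ℝ) + 1 + 1) * u = (n + 1) * u + u := by ring
      rw [e, h1]; ring
  have hle : ∀ s t : ℝ, 0 < s → s < δ → 0 < t → t < δ → φ s / s * t ≤ φ t / t * s := by
    intro s t hs hsδ ht htδ
    have hg : 0 ≤ φ s / s := div_nonneg (hφ.nonneg hs.le) hs.le
    have hN : ∀ N : ℕ, φ s / s * t - φ s / s * s * (1 / ((N : ℝ) + 1)) ≤ φ t / t * s := by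
      intro N
      -- Both s and t are measured in steps of u: s exactly, t up to one step. The error vanishes as
      -- N → ∞.
      set u := s / (N + 1) with hu
      have hu0 : 0 < u := by positivity
      have hsu : ((N : ℝ) + 1) * u = s := by rw [hu]; field_simp
      have h1 := hn N u hu0 (by rwa [hsu])
      rw [hsu] at h1
      have h2 : φ t / t ≥ ⌊t / u⌋₊ * (φ u / u) := by
        rcases Nat.eq_zero_or_pos ⌊t / u⌋₊ with h0 | h0
        · rw [h0]; simpa using div_nonneg (hφ.nonneg ht.le) ht.le
        · obtain ⟨m, hm⟩ := Nat.exists_eq_succ_of_ne_zero h0.ne'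
          have h3 : (⌊t / u⌋₊ : ℝ) * u ≤ t :=
            (le_div_iff₀ hu0).1 (Nat.floor_le (by positivity))
          rw [hm] at h3 ⊢
          push_cast at h3 ⊢
          rw [← hn m u hu0 (by linarith)]
          exact hφ.div_self_mono (by positivity) h3
      have h4 : t / u < ⌊t / u⌋₊ + 1 := Nat.lt_floor_add_one _
      rw [div_lt_iff₀ hu0] at h4
      have h5 : φ u / u * ((N : ℝ) + 1) = φ s / s := by rw [h1]; ring
      have hgu : 0 ≤ φ u / u := div_nonneg (hφ.nonneg hu0.le) hu0.le
      have h6 : φ s / s * t - φ s / s * s * (1 / ((N : ℝ) + 1)) =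
          φ u / u * ((N : ℝ) + 1) * (t - u) := by
        rw [h5, hu]; ring
      have h7 : φ u / u * ((N : ℝ) + 1) * (t - u) ≤
          φ u / u * ((N : ℝ) + 1) * (⌊t / u⌋₊ * u) :=
        mul_le_mul_of_nonneg_left (by linarith) (by positivity)
      calc _ = _ := h6
        _ ≤ _ := h7
        _ = (⌊t / u⌋₊ * (φ u / u)) * s := by rw [← hsu]; ring
        _ ≤ _ := mul_le_mul_of_nonneg_right h2 hs.le
    have hlim : Tendsto (fun N : ℕ => φ s / s * t - φ s / s * s * (1 / ((N : ℝ) + 1))) atTop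
        (𝓝 (φ s / s * t - φ s / s * s * 0)) :=
      tendsto_const_nhds.sub (tendsto_const_nhds.mul tendsto_one_div_add_atTop_nhds_zero_nat)
    rw [mul_zero, sub_zero] at hlim
    exact le_of_tendsto' hlim hN
  have hs : 0 < δ / 2 := by positivity
  have hsδ : δ / 2 < δ := by linarith
  refine ⟨φ (δ / 2) / (δ / 2) / (δ / 2), by have := hpos _ hs; positivity, δ, hδ,
    fun t ht htδ => ?_⟩
  rw [Real.rpow_two]
  rcases ht.eq_or_lt with rfl | ht
  · simp [hφ.map_zero]
  have h1 := le_antisymm (hle _ _ hs hsδ ht htδ) (hle _ _ ht htδ hs hsδ)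
  field_simp at h1 ⊢
  linarith

/-- Adding the equations for y and -y cancels the odd term in y; letting y → 0 gives g(ax) = α g(x)
for g(t) = φ(|t|)/t, and likewise g(by) = β g(y). So g is additive on small positive numbers. -/
theorem similarToPow_two_of_pexider_pos (hφ : IsOrliczFunction φ)
    (hpos : ∀ t : ℝ, 0 < t → 0 < φ t) {a b α β δ : ℝ} (ha : 0 < a) (hb : 0 < b) (hδ : 0 < δ)
    (h : ∀ x y : ℝ, |x| < δ → |y| < δ → x ≠ 0 → y ≠ 0 → a * x + b * y ≠ 0 →
      φ |a * x + b * y| / (a * x + b * y) = α * (φ |x| / x) + β * (φ |y| / y)) :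
    SimilarToPow φ 2 := by
  have half : ∀ {a b α β : ℝ}, 0 < a → 0 < b → (∀ x y : ℝ, |x| < δ → |y| < δ → x ≠ 0 → y ≠ 0 →
      a * x + b * y ≠ 0 →
      φ |a * x + b * y| / (a * x + b * y) = α * (φ |x| / x) + β * (φ |y| / y)) →
      ∀ x, 0 < x → x < δ → φ |a * x| / (a * x) = α * (φ |x| / x) := by
    intro a b α β ha hb h x hx hxδ
    have hax : 0 < a * x := mul_pos ha hx
    have hc : ContinuousAt (fun z => φ |z| / z) (a * x) :=
      hφ.continuous_comp_abs.continuousAt.div continuousAt_id hax.ne'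
    have hl : ∀ σ : ℝ, Tendsto (fun y => φ |a * x + b * (σ * y)| / (a * x + b * (σ * y))) (𝓝[>] 0)
        (𝓝 (φ |a * x| / (a * x))) := by
      intro σ
      refine Tendsto.comp hc (Tendsto.mono_left ?_ nhdsWithin_le_nhds)
      have : Continuous fun y : ℝ => a * x + b * (σ * y) := by fun_prop
      simpa using this.tendsto 0
    have hsum := (hl 1).add (hl (-1))
    have heq : (fun y => φ |a * x + b * (1 * y)| / (a * x + b * (1 * y)) +
        φ |a * x + b * (-1 * y)| / (a * x + b * (-1 * y))) =ᶠ[𝓝[>] 0]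
        fun _ => 2 * (α * (φ |x| / x)) := by
      have hm : Set.Ioo 0 (min δ (a * x / b)) ∈ 𝓝[>] (0 : ℝ) :=
        Ioo_mem_nhdsGT (lt_min hδ (by positivity))
      filter_upwards [hm] with y hy
      have hyδ : y < δ := hy.2.trans_le (min_le_left _ _)
      have hya : b * y < a * x := by
        have := hy.2.trans_le (min_le_right _ _)
        rwa [lt_div_iff₀ hb, mul_comm] at this
      have hby : 0 < b * y := mul_pos hb hy.1
      have hx' : |x| < δ := by rwa [abs_of_pos hx]
      have hy' : |y| < δ := by rwa [abs_of_pos hy.1]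
      have h1 := h x y hx' hy' hx.ne' hy.1.ne' (by linarith)
      have h2 := h x (-y) hx' (by rwa [abs_neg]) hx.ne' (neg_ne_zero.2 hy.1.ne')
        (by linarith)
      rw [one_mul, neg_one_mul, h1, h2, abs_neg, div_neg]
      ring
    have := tendsto_nhds_unique (hsum.congr' heq) tendsto_const_nhds
    linarith
  have h1 := half ha hb h
  have h2 := half (a := b) (b := a) (α := β) (β := α) hb ha fun x y hx hy hx0 hy0 hxy => by
    rw [add_comm (b * x), add_comm (β * _)]
    exact h y x hy hx hy0 hx0 (by rwa [add_comm])
  refine hφ.similarToPow_two_of_additive hpos (δ := min (a * δ) (b * δ))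
    (lt_min (by positivity) (by positivity)) fun s t hs ht hst => ?_
  have hsa : s / a < δ := by
    rw [div_lt_iff₀ ha]; linarith [min_le_left (a * δ) (b * δ)]
  have htb : t / b < δ := by
    rw [div_lt_iff₀ hb]; linarith [min_le_right (a * δ) (b * δ)]
  have hsa0 : 0 < s / a := by positivity
  have htb0 : 0 < t / b := by positivity
  have ea : a * (s / a) = s := by field_simp
  have eb : b * (t / b) = t := by field_simp
  have h3 := h (s / a) (t / b) (by rwa [abs_of_pos hsa0]) (by rwa [abs_of_pos htb0]) hsa0.ne'
    htb0.ne' (by rw [ea, eb]; positivity)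
  rw [← h1 _ hsa0 hsa, ← h2 _ htb0 htb, ea, eb, abs_of_pos hs, abs_of_pos ht,
    abs_of_pos (add_pos hs ht)] at h3
  exact h3

theorem similarToPow_two_of_pexider (hφ : IsOrliczFunction φ)
    (hpos : ∀ t : ℝ, 0 < t → 0 < φ t) {a b α β δ : ℝ} (ha : a ≠ 0) (hb : b ≠ 0) (hδ : 0 < δ)
    (h : ∀ x y : ℝ, |x| < δ → |y| < δ → x ≠ 0 → y ≠ 0 → a * x + b * y ≠ 0 →
      φ |a * x + b * y| / (a * x + b * y) = α * (φ |x| / x) + β * (φ |y| / y)) :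
    SimilarToPow φ 2 := by
  have hs : ∀ c : ℝ, c ≠ 0 → ∃ σ : ℝ, |σ| = 1 ∧ c * σ = |c| := by
    intro c hc
    rcases hc.lt_or_gt with h | h
    · exact ⟨-1, by simp, by rw [abs_of_neg h]; ring⟩
    · exact ⟨1, by simp, by rw [abs_of_pos h]; ring⟩
  obtain ⟨σ, hσ, hσa⟩ := hs a ha
  obtain ⟨τ, hτ, hτb⟩ := hs b hb
  have hσ0 : σ ≠ 0 := by rintro rfl; simp at hσ
  have hτ0 : τ ≠ 0 := by rintro rfl; simp at hτ
  refine hφ.similarToPow_two_of_pexider_pos hpos (α := α / σ) (β := β / τ) (abs_pos.2 ha)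
    (abs_pos.2 hb) hδ fun x y hx hy hx0 hy0 hxy => ?_
  have e : |a| * x + |b| * y = a * (σ * x) + b * (τ * y) := by rw [← hσa, ← hτb]; ring
  rw [e] at hxy ⊢
  rw [h (σ * x) (τ * y) (by rwa [abs_mul, hσ, one_mul]) (by rwa [abs_mul, hτ, one_mul])
    (mul_ne_zero hσ0 hx0) (mul_ne_zero hτ0 hy0) hxy, abs_mul, abs_mul, hσ, hτ, one_mul, one_mul]
  field_simp

end IsOrliczFunction

/-- `φ (c t)` is proportional to `φ t` near `0`. -/
def IsScaleFactor (φ : ℝ → ℝ) (c : ℝ) : Prop :=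
  ∃ K : ℝ, ∃ δ > 0, ∀ t : ℝ, 0 < t → t < δ → φ (c * t) = K * φ t

/-! ### Scale factors and comparison with powers. -/

namespace IsOrliczFunction

variable {φ : ℝ → ℝ}

theorem scale_pow {c K δ : ℝ} (hc : 0 < c) (hc1 : c ≤ 1)
    (h : ∀ t : ℝ, 0 < t → t < δ → φ (c * t) = K * φ t) (n : ℕ) {t : ℝ} (ht : 0 < t)
    (htδ : t < δ) : φ (c ^ n * t) = K ^ n * φ t := by
  induction n with
  | zero => simp
  | succ n ih =>
    have h1 : c ^ n * t ≤ t := mul_le_of_le_one_left ht.le (pow_le_one₀ hc.le hc1)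
    rw [pow_succ', mul_assoc, h _ (by positivity) (h1.trans_lt htδ), ih]
    ring

theorem scale_inv {c K δ : ℝ} (hpos : ∀ t : ℝ, 0 < t → 0 < φ t) (hc : 0 < c)
    (h : ∀ t : ℝ, 0 < t → t < δ → φ (c * t) = K * φ t) {t : ℝ} (ht : 0 < t) (htδ : t < c * δ) :
    φ (c⁻¹ * t) = K⁻¹ * φ t := by
  have h1 : c⁻¹ * t < δ := by rwa [inv_mul_lt_iff₀ hc]
  have h2 := h (c⁻¹ * t) (by positivity) h1
  rw [mul_inv_cancel_left₀ hc.ne'] at h2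
  have hK : K ≠ 0 := by
    rintro rfl
    have := hpos t ht
    rw [h2] at this; simp at this
  rw [h2, inv_mul_cancel_left₀ hK]

/-- Take p with c^p = K; convexity gives K ≤ c, hence p ≥ 1. Every small t is c^n s with s in a
fixed compact interval away from 0, and φ(t) and t^p both pick up the factor K^n. -/
theorem exists_equivalentToPow_of_lt_one (hφ : IsOrliczFunction φ)
    (hpos : ∀ t : ℝ, 0 < t → 0 < φ t) {c : ℝ} (hc : 0 < c) (hc1 : c < 1)
    (h : IsScaleFactor φ c) : ∃ p : ℝ, 1 ≤ p ∧ EquivalentToPow φ p := by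
  obtain ⟨K, δ, hδ, h⟩ := h
  set t₁ := δ / 2 with ht₁
  have ht₁0 : 0 < t₁ := by positivity
  have ht₁δ : t₁ < δ := by linarith
  have h1 := h t₁ ht₁0 ht₁δ
  have hK : 0 < K := by
    have h2 := hpos _ (mul_pos hc ht₁0)
    rw [h1] at h2
    exact pos_of_mul_pos_left h2 (hpos _ ht₁0).le
  have hKc : K ≤ c := by
    have h2 := hφ.mul_le hc.le hc1.le ht₁0.le
    rw [h1] at h2
    exact le_of_mul_le_mul_right h2 (hpos _ ht₁0)
  have hlog : Real.log c < 0 := Real.log_neg hc hc1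
  set p := Real.log K / Real.log c with hp
  have hcp : c ^ p = K := by
    rw [Real.rpow_def_of_pos hc, hp, mul_div_cancel₀ _ hlog.ne, Real.exp_log hK]
  have hp1 : 1 ≤ p := by
    rw [hp, le_div_iff_of_neg hlog, one_mul]
    exact Real.log_le_log hK hKc
  have hp0 : 0 < p := by linarith
  refine ⟨p, hp1, φ (c * t₁) / t₁ ^ p, div_pos (hpos _ (by positivity)) (by positivity),
    φ t₁ / (c * t₁) ^ p, div_pos (hpos _ ht₁0) (by positivity), t₁, ht₁0, fun t ht htt => ?_⟩
  rcases ht.eq_or_lt with rfl | ht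
  · simp [hφ.map_zero, Real.zero_rpow hp0.ne']
  obtain ⟨n, hn1, hn2⟩ := exists_nat_pow_near_of_lt_one (x := t / t₁) (y := c) (by positivity)
    (by rw [div_le_one ht₁0]; exact htt.le) hc hc1
  have hcn : 0 < c ^ n := by positivity
  set s := t / c ^ n with hs
  have hs0 : 0 < s := by positivity
  have hst : c ^ n * s = t := by rw [hs]; field_simp
  have hs1 : s ≤ t₁ := by
    rw [hs, div_le_iff₀ hcn]
    rwa [div_le_iff₀ ht₁0, mul_comm] at hn2
  have hs2 : c * t₁ ≤ s := by
    rw [hs, le_div_iff₀ hcn]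
    rw [lt_div_iff₀ ht₁0, pow_succ] at hn1
    linarith
  have hφt : φ t = K ^ n * φ s := by
    rw [← hst]; exact scale_pow hc hc1.le h n hs0 (hs1.trans_lt ht₁δ)
  have htp : t ^ p = K ^ n * s ^ p := by
    rw [← hst, Real.mul_rpow hcn.le hs0.le, ← hcp, ← Real.rpow_natCast_mul hc.le,
      mul_comm (n : ℝ), ← Real.rpow_mul_natCast hc.le]
  have hsp1 : s ^ p ≤ t₁ ^ p := Real.rpow_le_rpow hs0.le hs1 hp0.le
  have hsp2 : (c * t₁) ^ p ≤ s ^ p := Real.rpow_le_rpow (by positivity) hs2 hp0.le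
  have hct0 : 0 < c * t₁ := by positivity
  have hφ1 : φ s ≤ φ t₁ := hφ.monotone hs0.le ht₁0.le hs1
  have hφ2 : φ (c * t₁) ≤ φ s := hφ.monotone hct0.le hs0.le hs2
  have hp1' := hpos _ ht₁0
  have hp2' := hpos _ hct0
  rw [hφt, htp]
  constructor
  · rw [mul_left_comm]
    refine mul_le_mul_of_nonneg_left ?_ (by positivity)
    rw [div_mul_eq_mul_div, div_le_iff₀ (by positivity)]
    exact mul_le_mul hφ2 hsp1 (by positivity) (hp2'.le.trans hφ2)
  · rw [mul_left_comm]
    refine mul_le_mul_of_nonneg_left ?_ (by positivity)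
    rw [div_mul_eq_mul_div, le_div_iff₀ (by positivity)]
    exact mul_le_mul hφ1 hsp2 (by positivity) (by positivity)

theorem isScaleFactor_inv (hpos : ∀ t : ℝ, 0 < t → 0 < φ t) {c : ℝ} (hc : 0 < c)
    (h : IsScaleFactor φ c) : IsScaleFactor φ c⁻¹ := by
  obtain ⟨K, δ, hδ, h⟩ := h
  exact ⟨K⁻¹, c * δ, by positivity, fun t ht htδ => scale_inv hpos hc h ht htδ⟩

theorem exists_equivalentToPow (hφ : IsOrliczFunction φ)
    (hpos : ∀ t : ℝ, 0 < t → 0 < φ t) {c : ℝ} (hc : 0 < c) (hc1 : c ≠ 1)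
    (h : IsScaleFactor φ c) : ∃ p : ℝ, 1 ≤ p ∧ EquivalentToPow φ p := by
  rcases hc1.lt_or_gt with h1 | h1
  · exact hφ.exists_equivalentToPow_of_lt_one hpos hc h1 h
  · exact hφ.exists_equivalentToPow_of_lt_one hpos (inv_pos.2 hc) (inv_lt_one_of_one_lt₀ h1)
      (isScaleFactor_inv hpos hc h)

/-- Equivalence to t^p along the points c^n t keeps (K / c^p)^n between two positive constants for
all n. -/
theorem scale_eq_rpow_of_lt_one (hpos : ∀ t : ℝ, 0 < t → 0 < φ t) {c p K δ : ℝ} (hc : 0 < c)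
    (hc1 : c < 1) (hp : EquivalentToPow φ p) (hδ : 0 < δ)
    (h : ∀ t : ℝ, 0 < t → t < δ → φ (c * t) = K * φ t) : K = c ^ p := by
  obtain ⟨C₁, hC₁, C₂, hC₂, t₀, ht₀, hC⟩ := hp
  set t := min δ t₀ / 2 with ht
  have hm : 0 < min δ t₀ := lt_min hδ ht₀
  have ht0 : 0 < t := by positivity
  have htδ : t < δ := by linarith [min_le_left δ t₀]
  have htt : t < t₀ := by linarith [min_le_right δ t₀]
  have hφt := hpos t ht0
  have hcp : 0 < c ^ p := by positivity
  have htp : 0 < t ^ p := by positivity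
  have hK : 0 < K := by
    have h2 := hpos _ (mul_pos hc ht0)
    rw [h t ht0 htδ] at h2
    exact pos_of_mul_pos_left h2 hφt.le
  have key : ∀ n : ℕ, C₁ * t ^ p ≤ (K / c ^ p) ^ n * φ t ∧ (K / c ^ p) ^ n * φ t ≤ C₂ * t ^ p := by
    intro n
    have hcn : 0 < c ^ n := by positivity
    have h1 : c ^ n * t ≤ t := mul_le_of_le_one_left ht0.le (pow_le_one₀ hc.le hc1.le)
    have h2 := hC (c ^ n * t) (by positivity) (h1.trans_lt htt)
    have e : (c ^ n * t) ^ p = (c ^ p) ^ n * t ^ p := by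
      rw [Real.mul_rpow hcn.le ht0.le, ← Real.rpow_natCast_mul hc.le, mul_comm (n : ℝ),
        ← Real.rpow_mul_natCast hc.le]
    rw [scale_pow hc hc1.le h n ht0 htδ, e] at h2
    rw [div_pow, div_mul_eq_mul_div, le_div_iff₀ (by positivity), div_le_iff₀ (by positivity)]
    constructor <;> linarith [h2.1, h2.2]
  have hq : K / c ^ p = 1 := by
    rcases lt_trichotomy (K / c ^ p) 1 with hlt | heq | hgt
    · have := (tendsto_pow_atTop_nhds_zero_of_lt_one (by positivity) hlt).mul_const (φ t)
      rw [zero_mul] at this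
      have := ge_of_tendsto' this fun n => (key n).1
      have : 0 < C₁ * t ^ p := by positivity
      linarith
    · exact heq
    · obtain ⟨n, hn⟩ := pow_unbounded_of_one_lt (C₂ * t ^ p / φ t) hgt
      rw [div_lt_iff₀ hφt] at hn
      linarith [(key n).2]
  exact (div_eq_one_iff_eq hcp.ne').1 hq

theorem scale_eq_rpow (hpos : ∀ t : ℝ, 0 < t → 0 < φ t) {c p K δ : ℝ} (hc : 0 < c)
    (hp : EquivalentToPow φ p) (hδ : 0 < δ)
    (h : ∀ t : ℝ, 0 < t → t < δ → φ (c * t) = K * φ t) : K = c ^ p := by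
  rcases lt_trichotomy c 1 with h1 | rfl | h1
  · exact scale_eq_rpow_of_lt_one hpos hc h1 hp hδ h
  · have h2 := h (δ / 2) (by positivity) (by linarith)
    rw [one_mul] at h2
    rw [Real.one_rpow]
    have := hpos (δ / 2) (by positivity)
    field_simp at h2
    exact h2.symm
  · have := scale_eq_rpow_of_lt_one hpos (inv_pos.2 hc) (inv_lt_one_of_one_lt₀ h1) hp
      (mul_pos hc hδ) fun t ht htδ => scale_inv hpos hc h ht htδ
    rw [Real.inv_rpow hc.le] at this
    exact inv_injective this

/-- The logarithms of the factors `c` with `φ (c t) = c ^ p φ t` near `0`. -/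
def logScaleFactors (φ : ℝ → ℝ) (p : ℝ) : AddSubgroup ℝ where
  carrier := {x | ∃ δ > 0, ∀ t : ℝ, 0 < t → t < δ →
    φ (Real.exp x * t) = Real.exp (x * p) * φ t}
  zero_mem' := ⟨1, one_pos, by simp⟩
  add_mem' := by
    rintro x y ⟨δ, hδ, hx⟩ ⟨ε, hε, hy⟩
    refine ⟨min ε (δ / Real.exp y), lt_min hε (by positivity), fun t ht htδ => ?_⟩
    have h1 := htδ.trans_le (min_le_left _ _)
    have h2 := htδ.trans_le (min_le_right _ _)
    rw [lt_div_iff₀ (Real.exp_pos y), mul_comm] at h2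
    rw [Real.exp_add, mul_assoc, hx _ (by positivity) h2, hy t ht h1, add_mul, Real.exp_add,
      mul_assoc]
  neg_mem' := by
    rintro x ⟨δ, hδ, hx⟩
    refine ⟨Real.exp x * δ, by positivity, fun t ht htδ => ?_⟩
    have h1 : (Real.exp x)⁻¹ * t < δ := by rwa [inv_mul_lt_iff₀ (Real.exp_pos x)]
    have h2 := hx _ (by positivity) h1
    rw [mul_inv_cancel_left₀ (Real.exp_pos x).ne'] at h2
    rw [h2, Real.exp_neg, neg_mul, Real.exp_neg, inv_mul_cancel_left₀ (Real.exp_pos _).ne']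

/-- G(u) = φ(e^u) e^{-pu} is invariant under each translation in the subgroup, but only for u below
a bound depending on the translation. Translating by multiples of one fixed negative x₀ makes the
bound uniform; continuity and density then make G constant near -∞. -/
theorem similarToPow_of_dense (hφ : IsOrliczFunction φ) (hpos : ∀ t : ℝ, 0 < t → 0 < φ t)
    {p : ℝ} (hp : 1 ≤ p) (h : Dense (logScaleFactors φ p : Set ℝ)) : SimilarToPow φ p := by
  obtain ⟨x₀, hx₀, hx₀H⟩ := h.inter_open_nonempty (Set.Iio 0) isOpen_Iio ⟨-1, by simp⟩
  rw [Set.mem_Iio] at hx₀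
  obtain ⟨δ, hδ, hδx⟩ := hx₀H
  set G : ℝ → ℝ := fun u => φ |Real.exp u| * Real.exp (-(u * p)) with hG
  have hGc : Continuous G :=
    (hφ.continuous_comp_abs.comp Real.continuous_exp).mul (by fun_prop)
  have hstep : ∀ {x ε : ℝ}, (∀ t : ℝ, 0 < t → t < ε →
      φ (Real.exp x * t) = Real.exp (x * p) * φ t) → ∀ u, Real.exp u < ε → G (x + u) = G u := by
    intro x ε hx u hu
    simp only [hG, abs_of_pos (Real.exp_pos _)]
    rw [Real.exp_add, hx _ (Real.exp_pos u) hu]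
    have : Real.exp (-((x + u) * p)) = (Real.exp (x * p))⁻¹ * Real.exp (-(u * p)) := by
      rw [← Real.exp_neg, ← Real.exp_add]; congr 1; ring
    rw [this]
    field_simp
  have hiter : ∀ (n : ℕ) (u : ℝ), Real.exp u < δ → G (n * x₀ + u) = G u := by
    intro n u hu
    induction n with
    | zero => simp
    | succ n ih =>
      have e : ((n + 1 : ℕ) : ℝ) * x₀ + u = x₀ + (n * x₀ + u) := by push_cast; ring
      rw [e, hstep hδx _ (lt_of_le_of_lt (Real.exp_le_exp.2 ?_) hu), ih]
      have : (n : ℝ) * x₀ ≤ 0 := mul_nonpos_of_nonneg_of_nonpos (Nat.cast_nonneg n) hx₀.le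
      linarith
  have hH : ∀ x ∈ logScaleFactors φ p, ∀ u, Real.exp u < δ → Real.exp (x + u) < δ →
      G (x + u) = G u := by
    rintro x ⟨ε, hε, hx⟩ u hu hxu
    obtain ⟨n, hn⟩ := exists_nat_gt ((Real.log ε - u) / x₀)
    rw [div_lt_iff_of_neg hx₀] at hn
    have h1 : Real.exp (n * x₀ + u) < ε := by
      rw [← Real.lt_log_iff_exp_lt hε]; linarith
    rw [← hiter n u hu, ← hiter n (x + u) hxu, ← hstep hx _ h1]
    congr 1; ring
  set u₀ := Real.log (δ / 2)
  have hu₀ : Real.exp u₀ < δ := by rw [Real.exp_log (by positivity)]; linarith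
  have hconst : ∀ u, Real.exp u < δ → G u = G u₀ := by
    intro u hu
    by_contra hne
    have ho : IsOpen {x | Real.exp (x + u₀) < δ ∧ G (x + u₀) ≠ G u₀} := by
      refine IsOpen.and ?_ ?_
      · exact isOpen_lt (by fun_prop) continuous_const
      · exact isOpen_ne_fun (hGc.comp (continuous_add_const u₀)) continuous_const
    obtain ⟨x, ⟨hx1, hx2⟩, hxH⟩ := h.inter_open_nonempty _ ho
      ⟨u - u₀, by simpa using ⟨hu, hne⟩⟩
    exact hx2 (hH x hxH u₀ hu₀ hx1)
  refine ⟨G u₀, ?_, δ, hδ, fun t ht htδ => ?_⟩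
  · simp only [hG, abs_of_pos (Real.exp_pos _)]
    exact mul_pos (hpos _ (Real.exp_pos _)) (Real.exp_pos _)
  rcases ht.eq_or_lt with rfl | ht
  · rw [hφ.map_zero, Real.zero_rpow (by linarith), mul_zero]
  · rw [← hconst (Real.log t) (by rwa [Real.exp_log ht])]
    simp only [hG, Real.exp_log ht, abs_of_pos ht]
    rw [Real.rpow_def_of_pos ht, mul_assoc, ← Real.exp_add]
    simp

/-- A subgroup of ℝ is dense or cyclic, and density would make φ similar to t^p; γ is the
exponential of the absolute value of a generator. -/
theorem exists_base_of_scaleFactors (hφ : IsOrliczFunction φ) (hpos : ∀ t : ℝ, 0 < t → 0 < φ t)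
    {p : ℝ} (hp : 1 ≤ p) (hequiv : EquivalentToPow φ p) (hsim : ¬ SimilarToPow φ p) :
    ∃ γ : ℝ, 1 ≤ γ ∧ ∀ c : ℝ, 0 < c → IsScaleFactor φ c → ∃ m : ℤ, c = γ ^ m := by
  rcases (logScaleFactors φ p).dense_or_cyclic with h | ⟨a, ha⟩
  · exact absurd (hφ.similarToPow_of_dense hpos hp h) hsim
  refine ⟨Real.exp |a|, Real.one_le_exp (abs_nonneg a), fun c hc hcs => ?_⟩
  obtain ⟨K, δ, hδ, hK⟩ := hcs
  have hKp := scale_eq_rpow hpos hc hequiv hδ hK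
  have hmem : Real.log c ∈ logScaleFactors φ p := by
    refine ⟨δ, hδ, fun t ht htδ => ?_⟩
    rw [Real.exp_log hc, hK t ht htδ, hKp, Real.rpow_def_of_pos hc]
  rw [ha, AddSubgroup.mem_closure_singleton] at hmem
  obtain ⟨m, hm⟩ := hmem
  rw [zsmul_eq_mul] at hm
  rcases abs_choice a with h | h
  · refine ⟨m, ?_⟩
    rw [h, ← Real.rpow_intCast, ← Real.exp_mul, mul_comm, hm, Real.exp_log hc]
  · refine ⟨-m, ?_⟩
    rw [h, ← Real.rpow_intCast, ← Real.exp_mul, mul_comm]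
    push_cast
    rw [neg_mul_neg, hm, Real.exp_log hc]

end IsOrliczFunction

/-! ### The orthogonality relation in coordinates. -/

theorem dense_forall_sum_ne_zero {ι : Type*} (I : Finset ι) (B : Finset (ι → ℝ))
    (hB : ∀ b ∈ B, ∃ i ∈ I, b i ≠ 0) :
    Dense {s : ι → ℝ | ∀ b ∈ B, ∑ i ∈ I, b i * s i ≠ 0} := by
  classical
  have hcont : ∀ b : ι → ℝ, Continuous fun s : ι → ℝ => ∑ i ∈ I, b i * s i := fun b => by fun_prop
  have hone : ∀ b : ι → ℝ, (∃ i ∈ I, b i ≠ 0) → Dense {s : ι → ℝ | ∑ i ∈ I, b i * s i ≠ 0} := by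
    rintro b ⟨i, hi, hbi⟩ s
    by_cases hs : ∑ i ∈ I, b i * s i = 0
    · have hlim : Tendsto (fun n : ℕ => s + (1 / ((n : ℝ) + 1)) • (Pi.single i 1 : ι → ℝ)) atTop
          (𝓝 (s + (0 : ℝ) • (Pi.single i 1 : ι → ℝ))) :=
        tendsto_const_nhds.add (tendsto_one_div_add_atTop_nhds_zero_nat.smul_const _)
      rw [zero_smul, add_zero] at hlim
      refine mem_closure_of_tendsto hlim (Eventually.of_forall fun n => ?_)
      have h1 : ∑ j ∈ I, b j * (Pi.single i 1 : ι → ℝ) j = b i := by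
        simp [Pi.single_apply, hi]
      have h2 : ∑ j ∈ I, b j * (s + (1 / ((n : ℝ) + 1)) • (Pi.single i 1 : ι → ℝ)) j =
          1 / ((n : ℝ) + 1) * b i := by
        simp only [Pi.add_apply, Pi.smul_apply, smul_eq_mul, mul_add, Finset.sum_add_distrib, hs,
          zero_add]
        rw [← h1, Finset.mul_sum]
        exact Finset.sum_congr rfl fun j _ => by ring
      rw [Set.mem_ofPred_eq, h2]
      exact mul_ne_zero (by positivity) hbi
    · exact subset_closure hs
  have hopen : ∀ b : ι → ℝ, IsOpen {s : ι → ℝ | ∑ i ∈ I, b i * s i ≠ 0} := fun b =>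
    isOpen_ne_fun (hcont b) continuous_const
  induction B using Finset.induction_on with
  | empty => simp
  | insert b B _ ih =>
    have h1 := (hone b (hB b (Finset.mem_insert_self b B))).inter_of_isOpen_left
      (ih fun b' hb' => hB b' (Finset.mem_insert_of_mem hb')) (hopen b)
    refine h1.mono fun s hs => ?_
    simpa [Finset.forall_mem_insert] using hs

theorem Finset.sum_union_image_injective {ι κ : Type*} [Fintype κ] [DecidableEq ι] {a : κ → ι}
    (ha : Function.Injective a) {I : Finset ι} (hI : ∀ i ∈ I, i ∉ Set.range a) {M : Type*}
    [AddCommMonoid M] (g : ι → M) :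
    ∑ i ∈ I ∪ Finset.univ.image a, g i = ∑ i ∈ I, g i + ∑ k, g (a k) := by
  rw [Finset.sum_union, Finset.sum_image fun _ _ _ _ h => ha h]
  refine Finset.disjoint_left.2 fun i hi hi' => hI i hi ?_
  obtain ⟨k, -, rfl⟩ := Finset.mem_image.1 hi'
  exact ⟨k, rfl⟩

namespace IsOrliczFunction

variable {φ : ℝ → ℝ} {ι κ : Type*} {N : (ι → ℝ) → ℝ} [Fintype κ]

/-- Orthogonality for the vector of ker Q with coordinates s_i on I and -Σ c_{ki} s_i at a k, tested
against h = Σ d_k e_{a k}; the condition on d makes h vanish wherever that vector does. -/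
theorem sum_div_eq_sum_div (hφ : IsOrliczFunction φ)
    (hN : N = luxemburgNorm φ ∨ (N = orliczNorm φ ∧ ∀ u : ℝ, 0 ≤ u → youngConj φ u < ⊤))
    {Q : orliczSpace ι hφ →ₗ[ℝ] orliczSpace ι hφ} (hQ : ∀ x, N (x - Q x).1 ≤ N x.1)
    {o : ι} (ho : Q (orliczBasisVector hφ o) = 0) {a : κ → ι} (ha : Function.Injective a)
    {c : κ → ι → ℝ}
    (hc : ∀ i, Q (orliczBasisVector hφ i) = ∑ k, c k i • Q (orliczBasisVector hφ (a k)))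
    (hoa : o ∉ Set.range a) {I : Finset ι} (hoI : o ∉ I) (hI : ∀ i ∈ I, i ∉ Set.range a)
    {s : ι → ℝ} (hs : ∑ i ∈ I, φ |2 * s i| + ∑ k, φ |2 * ∑ i ∈ I, c k i * s i| < 1)
    {d : κ → ℝ} (hd : ∀ k, d k ≠ 0 → ∑ i ∈ I, c k i * s i ≠ 0) :
    ∑ i ∈ I, φ |s i| / s i * (Q (∑ k, d k • orliczBasisVector hφ (a k))).1 i =
      ∑ k, φ |∑ i ∈ I, c k i * s i| / (∑ i ∈ I, c k i * s i) *
        (Q (∑ k, d k • orliczBasisVector hφ (a k))).1 (a k) := by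
  classical
  set S := I ∪ Finset.univ.image a
  set x : ι → ℝ := Function.extend a (fun k => -∑ i ∈ I, c k i * s i) s with hx
  set h : ι → ℝ := Function.extend a d 0 with hh
  have hxa : ∀ k, x (a k) = -∑ i ∈ I, c k i * s i := fun k => ha.extend_apply _ _ k
  have hxI : ∀ i ∈ I, x i = s i := fun i hi => Function.extend_apply' _ _ _ (hI i hi)
  have hha : ∀ k, h (a k) = d k := fun k => ha.extend_apply _ _ k
  have hhI : ∀ i, i ∉ Set.range a → h i = 0 := fun i hi => Function.extend_apply' _ _ _ hi
  have hvh : finiteVector hφ S h = ∑ k, d k • orliczBasisVector hφ (a k) := by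
    unfold finiteVector
    rw [Finset.sum_union_image_injective ha hI, Finset.sum_eq_zero, zero_add]
    · simp only [hha]
    · intro i hi; rw [hhI i (hI i hi), zero_smul]
  have hoS : o ∉ S := by
    simp only [S, Finset.mem_union, Finset.mem_image, Finset.mem_univ, true_and, not_or]
    exact ⟨hoI, hoa⟩
  have key := hφ.sum_div_eq_zero hN hQ ho hoS (x := x) (h := h) ?_ ?_ ?_
  · rw [hvh, Finset.sum_union_image_injective ha hI] at key
    simp only [hxa, abs_neg, div_neg, neg_mul, Finset.sum_neg_distrib] at key
    rw [← sub_eq_zero, sub_eq_add_neg, ← key]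
    congr 1
    exact Finset.sum_congr rfl fun i hi => by rw [hxI i hi]
  · have hsum : ∑ i ∈ I, x i • Q (orliczBasisVector hφ i) =
        ∑ k, (∑ i ∈ I, c k i * s i) • Q (orliczBasisVector hφ (a k)) := by
      simp only [Finset.sum_smul]
      rw [Finset.sum_comm]
      refine Finset.sum_congr rfl fun i hi => ?_
      rw [hxI i hi, hc i, Finset.smul_sum]
      refine Finset.sum_congr rfl fun k _ => ?_
      rw [smul_smul, mul_comm]
    unfold finiteVector
    rw [Finset.sum_union_image_injective ha hI, map_add, map_sum, map_sum]
    simp only [map_smul, hxa]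
    rw [hsum, ← Finset.sum_add_distrib]
    refine Finset.sum_eq_zero fun k _ => ?_
    rw [← add_smul, add_neg_cancel, zero_smul]
  · intro i hi
    by_cases hia : i ∈ Set.range a
    · obtain ⟨k, rfl⟩ := hia
      rw [hha]
      by_contra hne
      exact hd k hne (by simpa [hxa] using hi)
    · exact hhI i hia
  · rw [Finset.sum_union_image_injective ha hI]
    simp only [hxa, mul_neg, abs_neg]
    rw [Finset.sum_congr rfl fun i hi => by rw [hxI i hi]]
    exact hs

theorem continuousAt_div_self (hφ : IsOrliczFunction φ) {t : ℝ} (ht : t ≠ 0) :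
    ContinuousAt (fun t => φ |t| / t) t :=
  hφ.continuous_comp_abs.continuousAt.div continuousAt_id ht

/-- The identity `sum_div_eq_sum_div` at sparse points, obtained by averaging over the signs of the
vanishing coordinates. -/
theorem sum_div_eq_sum_div_of_sparse (hφ : IsOrliczFunction φ)
    (hN : N = luxemburgNorm φ ∨ (N = orliczNorm φ ∧ ∀ u : ℝ, 0 ≤ u → youngConj φ u < ⊤))
    {Q : orliczSpace ι hφ →ₗ[ℝ] orliczSpace ι hφ} (hQ : ∀ x, N (x - Q x).1 ≤ N x.1)
    {o : ι} (ho : Q (orliczBasisVector hφ o) = 0) {a : κ → ι} (ha : Function.Injective a)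
    {c : κ → ι → ℝ}
    (hc : ∀ i, Q (orliczBasisVector hφ i) = ∑ k, c k i • Q (orliczBasisVector hφ (a k)))
    (hoa : o ∉ Set.range a) {I J : Finset ι} (hoI : o ∉ I) (hI : ∀ i ∈ I, i ∉ Set.range a)
    (hJI : J ⊆ I) (hwit : ∀ k, (∃ i, i ∉ Set.range a ∧ c k i ≠ 0) → ∃ i ∈ I, c k i ≠ 0)
    {d : κ → ℝ} (hd : ∀ k, d k ≠ 0 → ∃ i, i ∉ Set.range a ∧ c k i ≠ 0)
    {w : orliczSpace ι hφ} (hw : Q (∑ k, d k • orliczBasisVector hφ (a k)) = w)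
    {p : ι → ℝ} (hp : ∑ i ∈ I, φ |2 * p i| + ∑ k, φ |2 * ∑ i ∈ I, c k i * p i| < 1)
    (hpJ : ∀ i, i ∉ J → p i = 0) (hpJ' : ∀ i ∈ J, p i ≠ 0)
    (hpw : ∀ k, (∃ i, i ∉ Set.range a ∧ c k i ≠ 0) → w.1 (a k) ≠ 0 →
      ∑ i ∈ I, c k i * p i ≠ 0) :
    ∑ i ∈ J, φ |p i| / p i * w.1 i =
      ∑ k, φ |∑ i ∈ I, c k i * p i| / (∑ i ∈ I, c k i * p i) * w.1 (a k) := by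
  classical
  set L : κ → (ι → ℝ) → ℝ := fun k s => ∑ i ∈ I, c k i * s i with hL
  have hLc : ∀ k, Continuous (L k) := fun k => by simp only [hL]; fun_prop
  -- Flipping the signs outside J: the odd terms φ(|s_i|)/s_i there cancel between s and σ s. They
  -- need not tend to 0 as s_i → 0, for instance when φ(t) = t.
  set σ : (ι → ℝ) → ι → ℝ := fun s i => (if i ∈ J then 1 else -1) * s i with hσ
  have hσc : Continuous σ := by simp only [hσ]; fun_prop
  have hσp : σ p = p := by
    ext i
    by_cases hi : i ∈ J <;> simp [hσ, hi, hpJ i]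
  set K : Finset κ := Finset.univ.filter fun k => ∃ i, i ∉ Set.range a ∧ c k i ≠ 0 with hK
  have hKmem : ∀ k, k ∈ K ↔ ∃ i, i ∉ Set.range a ∧ c k i ≠ 0 := fun k => by simp [hK]
  -- The forms that must not vanish at s, nor at σ s, for the relation to be applicable at both
  -- points; generic points near p satisfy this.
  set B : Finset (ι → ℝ) := K.image c ∪
    K.image fun k i => c k i * (if i ∈ J then 1 else -1) with hB
  have hdense := dense_forall_sum_ne_zero I B (by
    intro b hb
    rcases Finset.mem_union.1 hb with hb | hb
    · obtain ⟨k, hk, rfl⟩ := Finset.mem_image.1 hb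
      exact hwit k ((hKmem k).1 hk)
    · obtain ⟨k, hk, rfl⟩ := Finset.mem_image.1 hb
      obtain ⟨i, hi, hci⟩ := hwit k ((hKmem k).1 hk)
      exact ⟨i, hi, mul_ne_zero hci (by split_ifs <;> norm_num)⟩)
  set D := {s : ι → ℝ | ∀ b ∈ B, ∑ i ∈ I, b i * s i ≠ 0} with hD
  have hDL : ∀ s ∈ D, ∀ k ∈ K, L k s ≠ 0 ∧ L k (σ s) ≠ 0 := by
    intro s hs k hk
    refine ⟨hs _ (Finset.mem_union_left _ (Finset.mem_image_of_mem c hk)), ?_⟩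
    have := hs _ (Finset.mem_union_right _ (Finset.mem_image_of_mem
      (fun k i => c k i * (if i ∈ J then 1 else -1)) hk))
    simpa only [hL, hσ, mul_assoc] using this
  have hne : (𝓝[D] p).NeBot := mem_closure_iff_nhdsWithin_neBot.1 (hdense p)
  have hU : ∀ᶠ s in 𝓝 p, ∑ i ∈ I, φ |2 * s i| + ∑ k, φ |2 * L k s| < 1 := by
    have hcont : Continuous fun s : ι → ℝ => ∑ i ∈ I, φ |2 * s i| + ∑ k, φ |2 * L k s| := by
      refine (continuous_finsetSum _ fun i _ => ?_).add (continuous_finsetSum _ fun k _ => ?_)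
      · exact hφ.continuous_comp_abs.comp (f := fun s : ι → ℝ => 2 * s i) (by fun_prop)
      · exact hφ.continuous_comp_abs.comp (f := fun s : ι → ℝ => 2 * L k s)
          (continuous_const.mul (hLc k))
    exact (hcont.tendsto p).eventually_lt_const hp
  have hUσ : ∀ᶠ s in 𝓝 p, ∑ i ∈ I, φ |2 * σ s i| + ∑ k, φ |2 * L k (σ s)| < 1 := by
    have := hσc.tendsto p
    rw [hσp] at this
    exact this.eventually hU
  have hE : ∀ᶠ s in 𝓝[D] p, 2 * ∑ i ∈ J, φ |s i| / s i * w.1 i =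
      ∑ k, (φ |L k s| / L k s * w.1 (a k) + φ |L k (σ s)| / L k (σ s) * w.1 (a k)) := by
    filter_upwards [nhdsWithin_le_nhds hU, nhdsWithin_le_nhds hUσ, self_mem_nhdsWithin]
      with s h1 h2 hs
    have e1 := hφ.sum_div_eq_sum_div hN hQ ho ha hc hoa hoI hI h1 (d := d)
      fun k hk => (hDL s hs k ((hKmem k).2 (hd k hk))).1
    have e2 := hφ.sum_div_eq_sum_div hN hQ ho ha hc hoa hoI hI h2 (d := d)
      fun k hk => (hDL s hs k ((hKmem k).2 (hd k hk))).2
    rw [hw] at e1 e2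
    rw [Finset.sum_add_distrib]
    refine Eq.trans ?_ (congrArg₂ (· + ·) e1 e2)
    rw [← Finset.sum_add_distrib, Finset.mul_sum, ← Finset.sum_subset hJI]
    · refine Finset.sum_congr rfl fun i hi => ?_
      simp only [hσ, if_pos hi, one_mul]; ring
    · intro i _ hi
      simp only [hσ, if_neg hi, neg_one_mul, abs_neg, div_neg]; ring
  have hl : Tendsto (fun s => 2 * ∑ i ∈ J, φ |s i| / s i * w.1 i) (𝓝[D] p)
      (𝓝 (2 * ∑ i ∈ J, φ |p i| / p i * w.1 i)) := by
    refine Tendsto.mono_left ?_ nhdsWithin_le_nhds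
    refine (tendsto_finsetSum _ fun i hi => Tendsto.mul_const _ ?_).const_mul _
    exact Tendsto.comp (f := fun s : ι → ℝ => s i) (hφ.continuousAt_div_self (hpJ' i hi))
      ((continuous_apply i).tendsto p)
  have hr : Tendsto (fun s => ∑ k, (φ |L k s| / L k s * w.1 (a k) +
      φ |L k (σ s)| / L k (σ s) * w.1 (a k))) (𝓝[D] p)
      (𝓝 (∑ k, (φ |L k p| / L k p * w.1 (a k) + φ |L k p| / L k p * w.1 (a k)))) := by
    refine Tendsto.mono_left ?_ nhdsWithin_le_nhds
    refine tendsto_finsetSum _ fun k _ => ?_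
    rcases eq_or_ne (w.1 (a k)) 0 with h0 | h0
    · simp [h0]
    by_cases hk : ∃ i, i ∉ Set.range a ∧ c k i ≠ 0
    · have h1 := hφ.continuousAt_div_self (hpw k hk h0)
      refine Tendsto.add (Tendsto.mul_const _ ?_) (Tendsto.mul_const _ ?_)
      · exact Tendsto.comp (f := L k) h1 ((hLc k).tendsto p)
      · refine Tendsto.comp (f := fun s => L k (σ s)) h1 ?_
        have : Tendsto (fun s => L k (σ s)) (𝓝 p) (𝓝 (L k (σ p))) :=
          ((hLc k).comp hσc).tendsto p
        rwa [hσp] at this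
    · have hz : ∀ s, L k s = 0 := fun s => Finset.sum_eq_zero fun i hi => by
        by_contra hne
        exact hk ⟨i, hI i hi, left_ne_zero_of_mul hne⟩
      simp [hz]
  have := tendsto_nhds_unique (hl.congr' hE) hr
  rw [Finset.sum_add_distrib] at this
  linarith

end IsOrliczFunction

/-! ### Structure of the coefficients. -/

namespace IsOrliczFunction

theorem sum_coeff_eq_zero {ι κ : Type*} {a : κ → ι} {c : κ → ι → ℝ} {k : κ}
    (hk : ¬ ∃ i, i ∉ Set.range a ∧ c k i ≠ 0) {I : Finset ι} (hI : ∀ i ∈ I, i ∉ Set.range a)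
    (p : ι → ℝ) : ∑ i ∈ I, c k i * p i = 0 :=
  Finset.sum_eq_zero fun i hi => by
    by_contra hne
    exact hk ⟨i, hI i hi, left_ne_zero_of_mul hne⟩

variable {φ : ℝ → ℝ} {ι κ : Type*} {N : (ι → ℝ) → ℝ} [Fintype κ]

open Classical in
theorem exists_forall_single_add_single_small (hφ : IsOrliczFunction φ) (I : Finset ι)
    (c : κ → ι → ℝ) (i j : ι) :
    ∃ δ > 0, ∀ x y : ℝ, |x| < δ → |y| < δ →
      ∑ l ∈ I, φ |2 * (Pi.single i x + Pi.single j y : ι → ℝ) l| +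
        ∑ k, φ |2 * ∑ l ∈ I, c k l * (Pi.single i x + Pi.single j y : ι → ℝ) l| < 1 := by
  have hcoord : ∀ l, Continuous fun q : ℝ × ℝ =>
      (Pi.single i q.1 + Pi.single j q.2 : ι → ℝ) l := by
    intro l
    simp only [Pi.add_apply, Pi.single_apply]
    split_ifs <;> fun_prop
  have hcont : Continuous fun q : ℝ × ℝ =>
      ∑ l ∈ I, φ |2 * (Pi.single i q.1 + Pi.single j q.2 : ι → ℝ) l| +
        ∑ k, φ |2 * ∑ l ∈ I, c k l * (Pi.single i q.1 + Pi.single j q.2 : ι → ℝ) l| := by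
    refine (continuous_finsetSum _ fun l _ => ?_).add (continuous_finsetSum _ fun k _ => ?_)
    · exact hφ.continuous_comp_abs.comp (continuous_const.mul (hcoord l))
    · exact hφ.continuous_comp_abs.comp (continuous_const.mul
        (continuous_finsetSum _ fun l _ => continuous_const.mul (hcoord l)))
  have := (hcont.tendsto (0, 0)).eventually_lt_const (u := 1) (by simp [hφ.map_zero])
  obtain ⟨δ, hδ, h⟩ := Metric.eventually_nhds_iff.1 this
  refine ⟨δ, hδ, fun x y hx hy => ?_⟩
  exact @h (x, y) (by simpa [Prod.dist_eq] using ⟨hx, hy⟩)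

/-- Call k active if c_{ki} ≠ 0 for some i outside the range of a. Finitely many indices i suffice
to detect all active k. -/
theorem exists_witness_finset {a : κ → ι} {c : κ → ι → ℝ} {o : ι} (hco : ∀ k, c k o = 0) :
    ∃ I : Finset ι, o ∉ I ∧ (∀ i ∈ I, i ∉ Set.range a) ∧
      ∀ k, (∃ i, i ∉ Set.range a ∧ c k i ≠ 0) → ∃ i ∈ I, c k i ≠ 0 := by
  classical
  have : ∀ k, ∃ i, (∃ i, i ∉ Set.range a ∧ c k i ≠ 0) → i ∉ Set.range a ∧ c k i ≠ 0 := by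
    intro k
    by_cases h : ∃ i, i ∉ Set.range a ∧ c k i ≠ 0
    · exact ⟨h.choose, fun _ => h.choose_spec⟩
    · exact ⟨o, fun h' => absurd h' h⟩
  choose W hW using this
  refine ⟨(Finset.univ.filter fun k => ∃ i, i ∉ Set.range a ∧ c k i ≠ 0).image W, ?_, ?_, ?_⟩
  · intro h
    obtain ⟨k, hk, hko⟩ := Finset.mem_image.1 h
    have := (hW k (Finset.mem_filter.1 hk).2).2
    rw [hko, hco] at this
    exact this rfl
  · intro i hi
    obtain ⟨k, hk, rfl⟩ := Finset.mem_image.1 hi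
    exact (hW k (Finset.mem_filter.1 hk).2).1
  · intro k hk
    exact ⟨W k, Finset.mem_image_of_mem _ (Finset.mem_filter.2 ⟨Finset.mem_univ k, hk⟩),
      (hW k hk).2⟩

/-- The sparse relation with J = {i} forces w_i = 0 off the range of a and o, so w is carried by e_o
and the inactive e_{a k}. Since Qw = w, comparison with the active combination d contradicts
independence unless d = 0. -/
theorem coeff_eq_zero_of_coords_eq_zero (hφ : IsOrliczFunction φ)
    (hpos : ∀ t : ℝ, 0 < t → 0 < φ t)
    (hN : N = luxemburgNorm φ ∨ (N = orliczNorm φ ∧ ∀ u : ℝ, 0 ≤ u → youngConj φ u < ⊤))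
    {Q : orliczSpace ι hφ →ₗ[ℝ] orliczSpace ι hφ} (hQ : ∀ x, N (x - Q x).1 ≤ N x.1)
    (hQQ : ∀ x, Q (Q x) = Q x)
    {o : ι} (ho : Q (orliczBasisVector hφ o) = 0) {a : κ → ι} (ha : Function.Injective a)
    {c : κ → ι → ℝ}
    (hc : ∀ i, Q (orliczBasisVector hφ i) = ∑ k, c k i • Q (orliczBasisVector hφ (a k)))
    (hli : LinearIndependent ℝ fun k => Q (orliczBasisVector hφ (a k)))
    (hoa : o ∉ Set.range a) (hco : ∀ k, c k o = 0)
    {d : κ → ℝ} (hd : ∀ k, d k ≠ 0 → ∃ i, i ∉ Set.range a ∧ c k i ≠ 0)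
    {w : orliczSpace ι hφ} (hw : Q (∑ k, d k • orliczBasisVector hφ (a k)) = w)
    (hwa : ∀ k, (∃ i, i ∉ Set.range a ∧ c k i ≠ 0) → w.1 (a k) = 0) : d = 0 := by
  classical
  obtain ⟨I₀, hoI₀, hI₀, hwit⟩ := exists_witness_finset (a := a) hco
  have hzero : ∀ i, i ∉ Set.range a → i ≠ o → w.1 i = 0 := by
    intro i hia hio
    have hI : ∀ l ∈ insert i I₀, l ∉ Set.range a := by
      intro l hl
      rcases Finset.mem_insert.1 hl with rfl | hl
      exacts [hia, hI₀ l hl]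
    obtain ⟨δ, hδ, hsmall⟩ := hφ.exists_forall_single_add_single_small (insert i I₀) c i i
    have hδ2 : |δ / 2| < δ := by rw [abs_of_pos (half_pos hδ)]; linarith
    have h1 := hφ.sum_div_eq_sum_div_of_sparse hN hQ ho ha hc hoa (I := insert i I₀) (J := {i})
      (by simp [hio.symm, hoI₀]) hI (by simp)
      (fun k hk => by
        obtain ⟨l, hl, hkl⟩ := hwit k hk
        exact ⟨l, Finset.mem_insert_of_mem hl, hkl⟩)
      hd hw (hsmall (δ / 2) 0 hδ2 (by simpa using hδ))
      (fun l hl => by simp [Finset.notMem_singleton.1 hl])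
      (fun l hl => by simp [Finset.mem_singleton.1 hl, hδ.ne'])
      (fun k hk hne => absurd (hwa k hk) hne)
    rw [Finset.sum_eq_zero (s := Finset.univ)] at h1
    · have h2 := hpos (δ / 2) (half_pos hδ)
      simpa [abs_of_pos (hδ), abs_of_pos (half_pos hδ), hδ.ne', h2.ne'] using h1
    · intro k _
      by_cases hk : ∃ i, i ∉ Set.range a ∧ c k i ≠ 0
      · rw [hwa k hk, mul_zero]
      · rw [sum_coeff_eq_zero hk hI, div_zero, zero_mul]
  have hsum : w = w.1 o • orliczBasisVector hφ o + ∑ k, w.1 (a k) • orliczBasisVector hφ (a k) := by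
    ext j
    have hj : (w.1 o • orliczBasisVector hφ o + ∑ k, w.1 (a k) • orliczBasisVector hφ (a k)).1 j =
        w.1 o * (if j = o then 1 else 0) + ∑ k, w.1 (a k) * (if j = a k then 1 else 0) := by
      simp [Finset.sum_apply, orliczBasisVector_apply]
    rw [hj]
    by_cases hja : j ∈ Set.range a
    · obtain ⟨k, rfl⟩ := hja
      have : a k ≠ o := fun h => hoa ⟨k, h⟩
      simp [this, ha.eq_iff]
    · have : ∀ k, j ≠ a k := fun k h => hja ⟨k, h.symm⟩
      rcases eq_or_ne j o with rfl | hjo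
      · simp [this]
      · simp [this, hjo, hzero j hja hjo]
  have hQw : Q w = ∑ k, w.1 (a k) • Q (orliczBasisVector hφ (a k)) := by
    conv_lhs => rw [hsum]
    rw [map_add, map_smul, ho, smul_zero, zero_add, map_sum]
    simp only [map_smul]
  have hQw' : Q w = ∑ k, d k • Q (orliczBasisVector hφ (a k)) := by
    rw [← hw, hQQ, map_sum]
    simp only [map_smul]
  have hdk := Fintype.linearIndependent_iffₛ.1 hli _ _ (hQw'.symm.trans hQw)
  ext k
  by_contra hne
  have := hdk k
  rw [hwa k (hd k hne)] at this
  exact hne this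

theorem exists_dual_coeff (hφ : IsOrliczFunction φ)
    (hpos : ∀ t : ℝ, 0 < t → 0 < φ t)
    (hN : N = luxemburgNorm φ ∨ (N = orliczNorm φ ∧ ∀ u : ℝ, 0 ≤ u → youngConj φ u < ⊤))
    {Q : orliczSpace ι hφ →ₗ[ℝ] orliczSpace ι hφ} (hQ : ∀ x, N (x - Q x).1 ≤ N x.1)
    (hQQ : ∀ x, Q (Q x) = Q x)
    {o : ι} (ho : Q (orliczBasisVector hφ o) = 0) {a : κ → ι} (ha : Function.Injective a)
    {c : κ → ι → ℝ}
    (hc : ∀ i, Q (orliczBasisVector hφ i) = ∑ k, c k i • Q (orliczBasisVector hφ (a k)))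
    (hli : LinearIndependent ℝ fun k => Q (orliczBasisVector hφ (a k)))
    (hoa : o ∉ Set.range a) (hco : ∀ k, c k o = 0) {k₀ : κ}
    (hk₀ : ∃ i, i ∉ Set.range a ∧ c k₀ i ≠ 0) :
    ∃ d : κ → ℝ, (∀ k, d k ≠ 0 → ∃ i, i ∉ Set.range a ∧ c k i ≠ 0) ∧
      (Q (∑ k, d k • orliczBasisVector hφ (a k))).1 (a k₀) = 1 ∧
      ∀ k, (∃ i, i ∉ Set.range a ∧ c k i ≠ 0) → k ≠ k₀ →
        (Q (∑ k, d k • orliczBasisVector hφ (a k))).1 (a k) = 0 := by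
  classical
  set V : (κ → ℝ) →ₗ[ℝ] orliczSpace ι hφ :=
    Fintype.linearCombination ℝ fun k => orliczBasisVector hφ (a k) with hV
  have hVd : ∀ d, V d = ∑ k, d k • orliczBasisVector hφ (a k) := fun d =>
    Fintype.linearCombination_apply ℝ _ d
  -- Identity rows at inactive k make the system square and, once solved for a unit vector at an
  -- active index, force d to vanish at inactive k.
  set T : (κ → ℝ) →ₗ[ℝ] (κ → ℝ) := LinearMap.pi fun k =>
    if ∃ i, i ∉ Set.range a ∧ c k i ≠ 0 then
      LinearMap.proj (a k) ∘ₗ (orliczSpace ι hφ).subtype ∘ₗ Q ∘ₗ V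
    else LinearMap.proj k with hT
  have hT1 : ∀ d k, (∃ i, i ∉ Set.range a ∧ c k i ≠ 0) → T d k = (Q (V d)).1 (a k) := by
    intro d k hk
    simp only [hT, LinearMap.pi_apply, if_pos hk]; rfl
  have hT2 : ∀ d k, (¬ ∃ i, i ∉ Set.range a ∧ c k i ≠ 0) → T d k = d k := by
    intro d k hk
    simp only [hT, LinearMap.pi_apply, if_neg hk]; rfl
  have hinj : Function.Injective T := by
    rw [← LinearMap.ker_eq_bot, LinearMap.ker_eq_bot']
    intro d hd0
    refine hφ.coeff_eq_zero_of_coords_eq_zero hpos hN hQ hQQ ho ha hc hli hoa hco (d := d)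
      (fun k hk => ?_) rfl fun k hk => ?_
    · by_contra hcon
      rw [← hT2 d k hcon, hd0] at hk
      exact hk rfl
    · rw [← hVd, ← hT1 d k hk, hd0]; rfl
  obtain ⟨d, hd⟩ := LinearMap.injective_iff_surjective.1 hinj (Pi.single k₀ 1)
  refine ⟨d, fun k hk => ?_, ?_, fun k hk hne => ?_⟩
  · by_contra hcon
    rw [← hT2 d k hcon, hd, Pi.single_eq_of_ne] at hk
    · exact hk rfl
    · rintro rfl; exact hcon hk₀
  · rw [← hVd, ← hT1 d k₀ hk₀, hd, Pi.single_eq_same]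
  · rw [← hVd, ← hT1 d k hk, hd, Pi.single_eq_of_ne hne]

/-- The dual choice of d leaves the single term k₀ on the right side of the sparse relation: at
other active k the coordinate of w is 0, and at inactive k the linear form is 0. -/
theorem exists_sparse_identity (hφ : IsOrliczFunction φ)
    (hpos : ∀ t : ℝ, 0 < t → 0 < φ t)
    (hN : N = luxemburgNorm φ ∨ (N = orliczNorm φ ∧ ∀ u : ℝ, 0 ≤ u → youngConj φ u < ⊤))
    {Q : orliczSpace ι hφ →ₗ[ℝ] orliczSpace ι hφ} (hQ : ∀ x, N (x - Q x).1 ≤ N x.1)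
    (hQQ : ∀ x, Q (Q x) = Q x)
    {o : ι} (ho : Q (orliczBasisVector hφ o) = 0) {a : κ → ι} (ha : Function.Injective a)
    {c : κ → ι → ℝ}
    (hc : ∀ i, Q (orliczBasisVector hφ i) = ∑ k, c k i • Q (orliczBasisVector hφ (a k)))
    (hli : LinearIndependent ℝ fun k => Q (orliczBasisVector hφ (a k)))
    (hoa : o ∉ Set.range a) (hco : ∀ k, c k o = 0) {k₀ : κ} {J : Finset ι}
    (hJ : ∀ i ∈ J, i ∉ Set.range a) (hoJ : o ∉ J)
    (hk₀ : ∃ i, i ∉ Set.range a ∧ c k₀ i ≠ 0) :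
    ∃ (I : Finset ι) (w : ι → ℝ), ∀ p : ι → ℝ,
      ∑ i ∈ I, φ |2 * p i| + ∑ k, φ |2 * ∑ i ∈ I, c k i * p i| < 1 →
      (∀ i, i ∉ J → p i = 0) → (∀ i ∈ J, p i ≠ 0) → ∑ i ∈ J, c k₀ i * p i ≠ 0 →
      φ |∑ i ∈ J, c k₀ i * p i| / (∑ i ∈ J, c k₀ i * p i) = ∑ i ∈ J, w i * (φ |p i| / p i) := by
  classical
  obtain ⟨I₀, hoI₀, hI₀, hwit⟩ := exists_witness_finset (a := a) hco
  obtain ⟨d, hd, hd1, hd0⟩ := hφ.exists_dual_coeff hpos hN hQ hQQ ho ha hc hli hoa hco hk₀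
  set w := Q (∑ k, d k • orliczBasisVector hφ (a k)) with hw
  have hI : ∀ l ∈ J ∪ I₀, l ∉ Set.range a := fun l hl =>
    (Finset.mem_union.1 hl).elim (hJ l) (hI₀ l)
  refine ⟨J ∪ I₀, w.1, fun p hp hpJ hpJ' hsum => ?_⟩
  have hIJ : ∑ i ∈ J ∪ I₀, c k₀ i * p i = ∑ i ∈ J, c k₀ i * p i :=
    (Finset.sum_subset Finset.subset_union_left fun i _ hi => by rw [hpJ i hi, mul_zero]).symm
  have h1 := hφ.sum_div_eq_sum_div_of_sparse hN hQ ho ha hc hoa (I := J ∪ I₀) (J := J)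
    (by simp [hoJ, hoI₀]) hI Finset.subset_union_left
    (fun k hk => by
      obtain ⟨l, hl, hkl⟩ := hwit k hk
      exact ⟨l, Finset.mem_union_right _ hl, hkl⟩)
    hd hw.symm hp hpJ hpJ' fun k hk hne => by
      have : k = k₀ := by
        by_contra hkk
        exact hne (hd0 k hk hkk)
      rwa [this, hIJ]
  rw [Finset.sum_eq_single k₀ (fun k _ hkk => ?_) (by simp), hd1, mul_one, hIJ] at h1
  · rw [← h1]
    exact Finset.sum_congr rfl fun i _ => mul_comm _ _
  · by_cases hk : ∃ i, i ∉ Set.range a ∧ c k i ≠ 0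
    · rw [hd0 k hk hkk, mul_zero]
    · rw [sum_coeff_eq_zero hk hI, div_zero, zero_mul]

/-- One-point sets J give the scale factor; a two-point J gives a Pexider equation, impossible when
φ is not similar to t². -/
theorem coeff_structure (hφ : IsOrliczFunction φ)
    (hpos : ∀ t : ℝ, 0 < t → 0 < φ t) (hsim : ¬ SimilarToPow φ 2)
    (hN : N = luxemburgNorm φ ∨ (N = orliczNorm φ ∧ ∀ u : ℝ, 0 ≤ u → youngConj φ u < ⊤))
    {Q : orliczSpace ι hφ →ₗ[ℝ] orliczSpace ι hφ} (hQ : ∀ x, N (x - Q x).1 ≤ N x.1)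
    (hQQ : ∀ x, Q (Q x) = Q x)
    {o : ι} (ho : Q (orliczBasisVector hφ o) = 0) {a : κ → ι} (ha : Function.Injective a)
    {c : κ → ι → ℝ}
    (hc : ∀ i, Q (orliczBasisVector hφ i) = ∑ k, c k i • Q (orliczBasisVector hφ (a k)))
    (hli : LinearIndependent ℝ fun k => Q (orliczBasisVector hφ (a k)))
    {k : κ} {i : ι} (hi : i ∉ Set.range a) (hki : c k i ≠ 0) :
    IsScaleFactor φ |c k i| ∧ ∀ j, j ∉ Set.range a → c k j ≠ 0 → j = i := by
  classical
  have hoa : o ∉ Set.range a := by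
    rintro ⟨k, rfl⟩
    exact hli.ne_zero k ho
  have hco : ∀ k, c k o = 0 :=
    Fintype.linearIndependent_iff.1 hli (fun k => c k o) ((hc o).symm.trans ho)
  have hne : ∀ j, c k j ≠ 0 → o ≠ j := by
    rintro j hj rfl
    exact hj (hco k)
  constructor
  · obtain ⟨I, w, h⟩ := hφ.exists_sparse_identity hpos hN hQ hQQ ho ha hc hli hoa hco (k₀ := k)
      (J := {i}) (by simpa using hi) (by simpa using hne i hki) ⟨i, hi, hki⟩
    obtain ⟨δ, hδ, hsmall⟩ := hφ.exists_forall_single_add_single_small I c i i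
    refine ⟨w i * c k i, δ, hδ, fun t ht htδ => ?_⟩
    have h1 := h _ (hsmall t 0 (by rwa [abs_of_pos ht]) (by simpa using hδ))
      (fun l hl => by simp [Finset.notMem_singleton.1 hl])
      (fun l hl => by simp [Finset.mem_singleton.1 hl, ht.ne'])
      (by simp [hki, ht.ne'])
    simp only [Finset.sum_singleton, Pi.single_zero, add_zero, Pi.single_eq_same, abs_mul,
      abs_of_pos ht] at h1
    field_simp at h1
    linarith
  · intro j hj hkj
    by_contra hji
    have hij : i ≠ j := fun h => hji h.symm
    obtain ⟨I, w, h⟩ := hφ.exists_sparse_identity hpos hN hQ hQQ ho ha hc hli hoa hco (k₀ := k)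
      (J := {i, j}) (by simpa using ⟨by simpa using hi, by simpa using hj⟩)
      (by simpa using ⟨hne i hki, hne j hkj⟩) ⟨i, hi, hki⟩
    obtain ⟨δ, hδ, hsmall⟩ := hφ.exists_forall_single_add_single_small I c i j
    refine hsim (hφ.similarToPow_two_of_pexider hpos hki hkj (α := w i) (β := w j) hδ
      fun x y hx hy hx0 hy0 hxy => ?_)
    have hpi : (Pi.single i x + Pi.single j y : ι → ℝ) i = x := by simp [hij]
    have hpj : (Pi.single i x + Pi.single j y : ι → ℝ) j = y := by simp [hji]
    have h1 := h _ (hsmall x y hx hy)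
      (fun l hl => by
        simp only [Finset.mem_insert, Finset.mem_singleton, not_or] at hl
        simp [hl.1, hl.2])
      (fun l hl => by
        rcases Finset.mem_insert.1 hl with rfl | hl
        · rwa [hpi]
        · rw [Finset.mem_singleton.1 hl, hpj]; exact hy0)
      (by rwa [Finset.sum_pair hij, hpi, hpj])
    rwa [Finset.sum_pair hij, Finset.sum_pair hij, hpi, hpj] at h1

end IsOrliczFunction

/-! ### The functionals that cut out `F`. -/

theorem coordFunctional_apply {ι : Type*} {φ : ℝ → ℝ} (hφ : IsOrliczFunction φ) (f : ι →₀ ℝ)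
    (x : orliczSpace ι hφ) {A : Finset ι} (hA : f.support ⊆ A) :
    coordFunctional hφ f x = ∑ i ∈ A, f i * x.1 i := by
  rw [← Finset.sum_subset hA fun i _ hi => by rw [Finsupp.notMem_support_iff.1 hi, zero_mul]]
  simp [coordFunctional]

theorem theorem4p1 {ι : Type*} [Countable ι] (φ : ℝ → ℝ) (hφ : IsOrliczFunction φ)
    (hpos : ∀ t : ℝ, 0 < t → 0 < φ t) (hsim : ¬ SimilarToPow φ 2)
    (N : (ι → ℝ) → ℝ)
    (hN : N = luxemburgNorm φ ∨
      (N = orliczNorm φ ∧ ∀ u : ℝ, 0 ≤ u → youngConj φ u < ⊤))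
    (n : ℕ) (F : Submodule ℝ (orliczSpace ι hφ))
    (hcodim : Module.rank ℝ (orliczSpace ι hφ ⧸ F) = (n : Cardinal))
    (hdim : 1 < Module.rank ℝ F)
    (hbasis : ∃ i : ι, orliczBasisVector hφ i ∈ F)
    (hF : IsOneComplemented hφ N F) :
    ∃ f : Fin n → ι →₀ ℝ,
      F = ⨅ j, LinearMap.ker (coordFunctional hφ (f j)) ∧
      (∀ j, (f j).support.card ≤ 2) ∧
      ((∀ p : ℝ, 1 ≤ p → ¬ EquivalentToPow φ p) → ∀ j i, |f j i| = 1 ∨ |f j i| = 0) ∧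
      ((∃ p : ℝ, 1 ≤ p ∧ EquivalentToPow φ p ∧ ¬ SimilarToPow φ p) →
        ∃ γ : ℝ, 1 ≤ γ ∧ ∀ j i, (∃ m : ℤ, |f j i| = γ ^ m) ∨ |f j i| = 0) := by
  classical
  obtain ⟨o, hoF⟩ := hbasis
  obtain ⟨P, hPP, hPF, ⟨-, hP⟩, -⟩ := hF
  have hPPx : ∀ x, P (P x) = P x := fun x => LinearMap.congr_fun hPP x
  set Q : orliczSpace ι hφ →ₗ[ℝ] orliczSpace ι hφ := LinearMap.id - P with hQdef
  have hQx : ∀ x, Q x = x - P x := fun x => rfl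
  have hQ : ∀ x, N (x - Q x).1 ≤ N x.1 := fun x => by
    rw [hQx, sub_sub_cancel]
    simpa using hP x
  have hQQ : ∀ x, Q (Q x) = Q x := fun x => by
    rw [hQx (Q x), hQx x, map_sub, hPPx, sub_self, sub_zero]
  have hQF : ∀ x, Q x = 0 ↔ x ∈ F := by
    intro x
    rw [hQx, sub_eq_zero, ← hPF, LinearMap.mem_range]
    constructor
    · exact fun h => ⟨x, h.symm⟩
    · rintro ⟨y, rfl⟩; exact (hPPx y).symm
  have ho := (hQF _).2 hoF
  have hfin : Module.Finite ℝ (orliczSpace ι hφ ⧸ F) :=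
    Module.finite_of_rank_eq_nat hcodim
  have hfinrank : Module.finrank ℝ (orliczSpace ι hφ ⧸ F) = n :=
    Module.finrank_eq_of_rank_eq hcodim
  -- A maximal independent subfamily of the classes of the e_i. That it spans the whole quotient,
  -- where the e_i need not be dense, is known only at `hspanF`.
  obtain ⟨κ, a, ha, hspan, hliF⟩ :=
    exists_linearIndependent' ℝ fun i => F.mkQ (orliczBasisVector hφ i)
  have : Finite κ := hliF.finite
  have : Fintype κ := Fintype.ofFinite κ
  have hmkQ : ∀ x, F.mkQ x = 0 ↔ Q x = 0 := fun x => by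
    rw [hQF, Submodule.mkQ_apply, Submodule.Quotient.mk_eq_zero]
  have hli : LinearIndependent ℝ fun k => Q (orliczBasisVector hφ (a k)) := by
    rw [Fintype.linearIndependent_iff]
    intro g hg
    refine Fintype.linearIndependent_iff.1 hliF g ?_
    simp only [← map_smul, ← map_sum] at hg
    have := (hmkQ _).2 hg
    rw [map_sum] at this
    simp only [map_smul] at this
    exact this
  have hex : ∀ i, ∃ c : κ → ℝ,
      ∑ k, c k • F.mkQ (orliczBasisVector hφ (a k)) = F.mkQ (orliczBasisVector hφ i) := by
    intro i
    refine (Submodule.mem_span_range_iff_exists_fun ℝ).1 ?_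
    exact hspan.ge (Submodule.subset_span ⟨i, rfl⟩)
  choose c' hc' using hex
  set c : κ → ι → ℝ := fun k i => c' i k with hcdef
  have hc : ∀ i, Q (orliczBasisVector hφ i) = ∑ k, c k i • Q (orliczBasisVector hφ (a k)) := by
    intro i
    have h1 : F.mkQ (orliczBasisVector hφ i - ∑ k, c k i • orliczBasisVector hφ (a k)) = 0 := by
      rw [map_sub, ← hc' i, map_sum]
      simp only [map_smul, hcdef, sub_self]
    have h2 := (hmkQ _).1 h1
    rw [map_sub, map_sum, sub_eq_zero] at h2
    simpa only [map_smul] using h2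
  have hca : ∀ k k', c k (a k') = if k = k' then 1 else 0 := by
    intro k k'
    refine Fintype.linearIndependent_iffₛ.1 hli (fun k => c k (a k'))
      (fun k => if k = k' then 1 else 0) ?_ k
    simp [← hc (a k')]
  have hstr : ∀ k i, i ∉ Set.range a → c k i ≠ 0 →
      IsScaleFactor φ |c k i| ∧ ∀ j, j ∉ Set.range a → c k j ≠ 0 → j = i := fun k i hi hki =>
    hφ.coeff_structure hpos hsim hN hQ hQQ ho ha hc hli hi hki
  have hval : ∀ k i, c k i ≠ 0 → |c k i| = 1 ∨ IsScaleFactor φ |c k i| := by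
    intro k i hki
    by_cases hi : i ∈ Set.range a
    · obtain ⟨k', rfl⟩ := hi
      rw [hca] at hki ⊢
      left
      split_ifs with h
      · simp
      · simp [h] at hki
    · exact Or.inr (hstr k i hi hki).1
  have hsupp : ∀ k, ∃ T : Finset ι, T.card ≤ 2 ∧ ∀ i, c k i ≠ 0 → i ∈ T := by
    intro k
    have hka : ∀ i, i ∈ Set.range a → c k i ≠ 0 → i = a k := by
      rintro _ ⟨k', rfl⟩ h
      rw [hca] at h
      by_cases hkk : k = k'
      · rw [hkk]
      · simp [hkk] at h
    by_cases hk : ∃ i, i ∉ Set.range a ∧ c k i ≠ 0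
    · obtain ⟨i, hi, hki⟩ := hk
      refine ⟨{a k, i}, Finset.card_le_two, fun j hj => ?_⟩
      by_cases hja : j ∈ Set.range a
      · simp [hka j hja hj]
      · simp [(hstr k i hi hki).2 j hja hj]
    · refine ⟨{a k}, by simp, fun j hj => ?_⟩
      by_cases hja : j ∈ Set.range a
      · simp [hka j hja hj]
      · exact absurd ⟨j, hja, hj⟩ hk
  choose T hTcard hT using hsupp
  set g : κ → ι →₀ ℝ := fun k => Finsupp.onFinset (T k) (c k) (hT k) with hg
  have hgc : ∀ k i, g k i = c k i := fun k i => rfl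
  have hgT : ∀ k, (g k).support ⊆ T k := fun k => Finsupp.support_onFinset_subset
  -- Once a truncation contains every support `T k`, its image under Q has the coefficients f_k(x) =
  -- 0, so the truncation lemma applies.
  have hsub : ∀ x, (∀ k, coordFunctional hφ (g k) x = 0) → x ∈ F := by
    intro x hx
    rw [← hQF]
    refine hφ.eq_zero_of_truncations hpos hN hQ hQQ ho fun S => ?_
    refine ⟨S ∪ Finset.univ.biUnion T, Finset.subset_union_left, ?_⟩
    unfold finiteVector
    rw [map_sum]
    have h0 : ∀ i, Q (x.1 i • orliczBasisVector hφ i) =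
        ∑ k, (x.1 i * c k i) • Q (orliczBasisVector hφ (a k)) := fun i => by
      rw [map_smul, hc i, Finset.smul_sum]
      simp only [smul_smul]
    rw [Finset.sum_congr rfl fun i _ => h0 i, Finset.sum_comm]
    refine Finset.sum_eq_zero fun k _ => ?_
    rw [← Finset.sum_smul]
    have h1 := coordFunctional_apply hφ (g k) x (A := S ∪ Finset.univ.biUnion T)
      ((hgT k).trans ((Finset.subset_biUnion_of_mem T (Finset.mem_univ k)).trans
        Finset.subset_union_right))
    rw [hx k] at h1
    simp only [hgc] at h1
    rw [Finset.sum_congr rfl fun i _ => mul_comm _ _, ← h1, zero_smul]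
  have hga : ∀ k k', coordFunctional hφ (g k) (orliczBasisVector hφ (a k')) =
      if k = k' then 1 else 0 := by
    intro k k'
    rw [coordFunctional_apply hφ (g k) _ (Finset.subset_insert (a k') _),
      Finset.sum_eq_single (a k')]
    · simp [hgc, hca, IsOrliczFunction.orliczBasisVector_apply]
    · intro i _ hi
      simp [IsOrliczFunction.orliczBasisVector_apply, hi]
    · simp
  have hdecomp : ∀ x, x - ∑ k, coordFunctional hφ (g k) x • orliczBasisVector hφ (a k) ∈ F := by
    intro x
    refine hsub _ fun k => ?_
    rw [map_sub, map_sum, Finset.sum_eq_single k, map_smul, hga, if_pos rfl, smul_eq_mul, mul_one,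
      sub_self]
    · intro k' _ h
      rw [map_smul, hga, if_neg h.symm, smul_zero]
    · exact fun h => absurd (Finset.mem_univ k) h
  have hspanF : ⊤ ≤ Submodule.span ℝ
      (Set.range ((fun i => F.mkQ (orliczBasisVector hφ i)) ∘ a)) := by
    rintro y -
    obtain ⟨x, rfl⟩ := F.mkQ_surjective y
    refine (Submodule.mem_span_range_iff_exists_fun ℝ).2 ⟨fun k => coordFunctional hφ (g k) x, ?_⟩
    have h1 := (hmkQ _).2 ((hQF _).2 (hdecomp x))
    rw [map_sub, sub_eq_zero, map_sum] at h1
    simpa only [map_smul, Function.comp_apply] using h1.symm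
  -- Spanning turns the independent classes into a basis of the quotient, so there are exactly as
  -- many functionals as the codimension.
  have hcard : Fintype.card κ = n := by
    rw [← hfinrank, Module.finrank_eq_card_basis (Module.Basis.mk hliF hspanF)]
  have hmem : ∀ x, x ∈ F ↔ ∀ k, coordFunctional hφ (g k) x = 0 := by
    refine fun x => ⟨fun hx => ?_, hsub x⟩
    refine Fintype.linearIndependent_iff.1 hli _ ?_
    have h1 := (hQF _).2 (hdecomp x)
    rw [map_sub, (hQF x).2 hx, zero_sub, neg_eq_zero, map_sum] at h1
    simpa only [map_smul] using h1
  set e : Fin n ≃ κ := (Fintype.equivFinOfCardEq hcard).symm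
  refine ⟨fun j => g (e j), ?_, fun j => (Finset.card_le_card (hgT _)).trans (hTcard _), ?_, ?_⟩
  · ext x
    rw [hmem, Submodule.mem_iInf, ← e.forall_congr_right]
    simp only [LinearMap.mem_ker]
  · intro hne j i
    rw [hgc]
    by_cases h0 : c (e j) i = 0
    · right; simp [h0]
    left
    by_contra h1
    have h2 := (hval _ _ h0).resolve_left h1
    obtain ⟨p, hp, hp'⟩ := hφ.exists_equivalentToPow hpos (abs_pos.2 h0) h1 h2
    exact hne p hp hp'
  · rintro ⟨p, hp, hequiv, hnsim⟩
    obtain ⟨γ, hγ, h⟩ := hφ.exists_base_of_scaleFactors hpos hp hequiv hnsim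
    refine ⟨γ, hγ, fun j i => ?_⟩
    rw [hgc]
    by_cases h0 : c (e j) i = 0
    · right; simp [h0]
    left
    rcases hval _ _ h0 with h1 | h1
    · exact ⟨0, by simp [h1]⟩
    · exact h _ (abs_pos.2 h0) h1
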